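/- **Theorem (Quadratic Recursion).** For a real matrix $\mathbf A$ and $p>0$ let $\|\mathbf A\|_{p}=\big(\operatorname{tr}\,(\mathbf A^{\mathsf T}\mathbf A)^{p/2}\big)^{1/p}$ denote the Schatten $p$-norm. Let $x_1,\dots,x_n$ be i.i.d. real random variables with $\mathbb E x_i=0$, $\mathbb E x_i^2=1$ and $|x_i|\le L$ almost surely for all $i$. Let $\mathbf A_{i,j}\in\mathbb R^{d_1\times d_2}$ ($1\le i,j\le n$, $i\ne j$) be deterministic matrices with $\mathbf A_{i,j}=\mathbf A_{j,i}$ for all $i\neq j$, and set $$\mathbf F(\mathbf x)=\sum_{i\ne j}\mathbf A_{i,j}\,x_ix_j ,$$ the sum being over all ordered pairs $(i,j)$ of distinct indices. For integers $a,b,c\ge 0$ with $a+b+c=2$ let $\mathbf F_{a,b,c}$ be the deterministic block matrix with blocks $\mathbf A_{i,j}$ for $i\neq j$ and $\mathbf 0$ for $i=j$, in which $a$ of the two block indices $i,j$ are arranged vertically (blocks stacked in a column), $b$ horizontally (blocks side by side in a row) and $c$ diagonally (blocks on the diagonal of a block diagonal matrix). For example, $\mathbf F_{1,1,0}$ is the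 $n\times n$ block matrix with $(i,j)$ block $\mathbf A_{i,j}$, $\mathbf F_{0,2,0}$ is the block row of all the blocks, and $\mathbf F_{0,1,1}$ is the block diagonal matrix whose $i$-th diagonal block is the block row $[\mathbf A_{i,1}\ \cdots\ \mathbf A_{i,n}]$ (with $\mathbf A_{i,i}$ read as $\mathbf 0$). If the two arrangements differ, they may be nested in either order, chosen separately for each $(a,b,c)$. Then for every real $t$ with $2\le t<\infty$, $\|\mathbf F(\mathbf x)-\mathbb E\,\mathbf F(\mathbf x)\|_{4t}$ is integrable and $$\mathbb E\,\|\mathbf F(\mathbf x)-\mathbb E\,\mathbf F(\mathbf x)\|_{4t}\ \le\ 2(32t)^2\sum_{\substack{a,b,c\ge 0\\ a+b+c=2}}L^{c}\,\|\mathbf F_{a,b,c}\|_{4t}.$$ The same inequality holds if $\mathbf F_{a,b,c}$ is instead the block matrix of the second order partial derivatives of $\mathbf F$, obtained from $\mathbf F_{0,0,0}=\mathbf F$ by the recursion in which increasing $a$ (respectively $b$, $c$) by one replaces the current matrix $\mathbf G$ by the matrix with blocks $\partial_{x_1}\mathbf G,\dots,\partial_{x_n}\mathbf G$ arranged vertically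 (respectively horizontally, diagonally), the increments being made in any order. -/

import Mathlib

open MeasureTheory ProbabilityTheory

noncomputable section

namespace MatrixChaos

/-- The Schatten `p`-norm `(tr (Aᵀ A)^(p/2))^(1/p)` of a real matrix: the trace of the power is the
sum of the powers of the (nonnegative) eigenvalues of `Aᵀ A`, i.e. of the squared singular values
of `A` (zero singular values contribute nothing for `p > 0`). -/
def schattenNorm {ι κ : Type*} [Fintype ι] [Fintype κ] [DecidableEq κ]
    (p : ℝ) (A : Matrix ι κ ℝ) : ℝ :=
  (∑ k, (Matrix.isHermitian_conjTranspose_mul_self A).eigenvalues k ^ (p / 2)) ^ (1 / p)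

/-- The three ways of arranging `n` blocks: vertically (this increments `a` in `F_{a,b,c}`),
horizontally (increments `b`) and diagonally (increments `c`). -/
inductive Dir
  | vert
  | horiz
  | diag
  deriving DecidableEq

/-- Row indices after arranging `n` blocks with rows `ι`. -/
abbrev Dir.Row (n : ℕ) (ι : Type*) : Dir → Type _
  | .vert => Fin n × ι
  | .horiz => ι
  | .diag => Fin n × ι

/-- Column indices after arranging `n` blocks with columns `κ`. -/
abbrev Dir.Col (n : ℕ) (κ : Type*) : Dir → Type _
  | .vert => κ
  | .horiz => Fin n × κ
  | .diag => Fin n × κ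

instance (n : ℕ) (ι : Type*) [Fintype ι] : (u : Dir) → Fintype (u.Row n ι)
  | .vert => inferInstanceAs (Fintype (Fin n × ι))
  | .horiz => inferInstanceAs (Fintype ι)
  | .diag => inferInstanceAs (Fintype (Fin n × ι))

instance (n : ℕ) (κ : Type*) [Fintype κ] : (u : Dir) → Fintype (u.Col n κ)
  | .vert => inferInstanceAs (Fintype κ)
  | .horiz => inferInstanceAs (Fintype (Fin n × κ))
  | .diag => inferInstanceAs (Fintype (Fin n × κ))

instance (n : ℕ) (κ : Type*) [DecidableEq κ] : (u : Dir) → DecidableEq (u.Col n κ)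
  | .vert => inferInstanceAs (DecidableEq κ)
  | .horiz => inferInstanceAs (DecidableEq (Fin n × κ))
  | .diag => inferInstanceAs (DecidableEq (Fin n × κ))

/-- The block matrix with blocks `B 1, …, B n` arranged vertically, horizontally or diagonally. -/
def Dir.arrange {n : ℕ} {ι κ R : Type*} [Zero R] (B : Fin n → Matrix ι κ R) :
    (u : Dir) → Matrix (u.Row n ι) (u.Col n κ) R
  | .vert => Matrix.of fun (p : Fin n × ι) (s : κ) => B p.1 p.2 s
  | .horiz => Matrix.of fun (r : ι) (q : Fin n × κ) => B q.1 r q.2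
  | .diag => Matrix.of fun (p : Fin n × ι) (q : Fin n × κ) => if p.1 = q.1 then B p.1 p.2 q.2 else 0

/-- A matrix-valued polynomial in `x_1, …, x_n`. -/
abbrev PolyMatrix (n : ℕ) (ι κ : Type*) := Matrix ι κ (MvPolynomial (Fin n) ℝ)

/-- The value `F(x)`. -/
def PolyMatrix.evalAt {n : ℕ} {ι κ : Type*} (F : PolyMatrix n ι κ) (x : Fin n → ℝ) :
    Matrix ι κ ℝ :=
  F.map (MvPolynomial.eval x)

/-- One step of the recursion for `F_{a,b,c}`: the block matrix of the first order partial
derivatives `∂_{x_1} F, …, ∂_{x_n} F`, arranged in the direction `u`. -/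
def PolyMatrix.derivBlock {n : ℕ} {ι κ : Type*} (F : PolyMatrix n ι κ) (u : Dir) :
    PolyMatrix n (u.Row n ι) (u.Col n κ) :=
  u.arrange fun i => F.map (MvPolynomial.pderiv i)

/-- The quadratic matrix polynomial `F(x) = ∑_{i ≠ j} A_{i,j} x_i x_j`. The matrices `A i i` are
not used. -/
def quadratic {n : ℕ} {ι κ : Type*} (A : Fin n → Fin n → Matrix ι κ ℝ) : PolyMatrix n ι κ :=
  Matrix.of fun r s => ∑ p ∈ (Finset.univ : Finset (Fin n)).offDiag,
    MvPolynomial.C (A p.1 p.2 r s) * MvPolynomial.X p.1 * MvPolynomial.X p.2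

/-- The block matrix with blocks `A_{i,j}` for `i ≠ j` and `0` for `i = j`, where the index `i` is
arranged (outside) in the direction `u` and `j` (inside) in the direction `v`. -/
def coeffBlock {n : ℕ} {ι κ : Type*} (A : Fin n → Fin n → Matrix ι κ ℝ) (u v : Dir) :
    Matrix (u.Row n (v.Row n ι)) (u.Col n (v.Col n κ)) ℝ :=
  u.arrange fun i => v.arrange fun j => if i = j then 0 else A i j

/-- Among the two directions `u, v` there are `k 0` vertical, `k 1` horizontal and `k 2` diagonal
ones: applying `v` and then `u` is one of the orders of increments that lead from `F = F_{0,0,0}`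
to `F_{a,b,c}`, where `(a, b, c) = (k 0, k 1, k 2)`. -/
def IsOrder (u v : Dir) (k : Fin 3 → ℕ) : Prop :=
  [u, v].count Dir.vert = k 0 ∧ [u, v].count Dir.horiz = k 1 ∧ [u, v].count Dir.diag = k 2

/-- The entrywise expectation of a random matrix. -/
def expectation {Ω : Type*} [MeasurableSpace Ω] (P : Measure Ω) {ι κ : Type*}
    (M : Ω → Matrix ι κ ℝ) : Matrix ι κ ℝ :=
  Matrix.of fun r s => ∫ ω, M ω r s ∂P

end MatrixChaos

end

/-!
Let `p = 4 t` and `q = p / 2`. All estimates are made for the `p`-th power of the Schatten norm,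
which is a trace, and the expectation of the norm is bounded at the end by convexity.

The basic tool is a formula for the trace of a function of `A` times a function of `B`
(`exists_trace_cfc_mul_cfc`): it is a nonnegative combination of products of values at the
eigenvalues of `A` and `B`. Inequalities between two real numbers, such as the mean value theorem
and Young's inequality, thus become trace inequalities, and no Hölder inequality for Schatten norms
is needed.

*Linear sums.* Let `X = ∑ x i • H i` with symmetric `H i`. Resampling the coordinate `x i`
expresses `E trace (x i H i X |X| ^ (p - 2))` as half the expectation of a product of differences,
and the mean value trace inequality bounds this by a multiple of
`E (x i ^ 2 + 1) trace (H i ^ 2 |X| ^ (p - 2))`. Summation over `i` and Young's inequality bound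
`E trace |X| ^ p` by the `q`-th moments of `∑ H i ^ 2` and `S = ∑ x i ^ 2 • H i ^ 2`
(`integral_tracePow_le_of_sq`). The same argument with `x i ^ 2` in place of `x i` bounds
`E trace S ^ q` (`integral_tracePow_sq_le`). The symmetric dilation carries the result over to
rectangular matrices: the `p`-th moment of `∑ x i • B i` is at most `(4 p) ^ p` times the sum of
the `p`-th powers of the norms of the vertical, the horizontal, and `L` times the diagonal
arrangement of the `B i` (`integral_schattenNorm_rpow_sum_smul_le`).

*Quadratic sums.* The polynomial is the average over all index sets `S` of four times its part with
`i ∈ S` and `j ∉ S`. In that part the two families of variables are independent, and the linear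
bound, applied to one family and then to the other, produces the block matrices for all nine
ordered pairs of directions. The symmetry of the coefficients identifies the two orders of distinct
directions, which leaves twice the sum over the six triples; the constants combine to
`4 * (4 p) ^ 2 * 2 = 2 * (32 t) ^ 2`. The second order derivatives are twice the coefficients, so
that the bound in terms of them is weaker.
-/

namespace MatrixChaos

open Matrix

/-! ### Functional calculus of symmetric matrices -/

open scoped Matrix.Norms.L2Operator in
/-- The functional calculus of a continuous function is continuous on symmetric matrices. The
operator norm enters only through the continuity theorem for isometric functional calculi; it
induces the usual topology. -/
theorem continuous_cfc_of_isHermitian {T ι : Type*} [TopologicalSpace T] [Fintype ι] [DecidableEq ι]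
    {g : ℝ → ℝ} (hg : Continuous g) {X : T → Matrix ι ι ℝ} (hX : Continuous X)
    (hs : ∀ x, (X x).IsHermitian) : Continuous fun x => cfc g (X x) :=
  Continuous.cfc_of_mem_nhdsSet (𝕜 := ℝ) (p := IsSelfAdjoint) (s := Set.univ) g Filter.univ_mem hX
    (fun x => (hs x).isSelfAdjoint) hg.continuousOn

section cfc
variable {ι : Type*} [Fintype ι] [DecidableEq ι] {A B : Matrix ι ι ℝ}

/-- Every function is admissible here, since the spectrum is finite. -/
theorem cfc_mul_cfc (hA : A.IsHermitian) (f g : ℝ → ℝ) :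
    cfc f A * cfc g A = cfc (fun x : ℝ => f x * g x) A := by
  simp only [hA.cfc_eq, IsHermitian.cfc, ← map_mul, diagonal_mul_diagonal]
  rfl

theorem cfc_id_of_isHermitian (hA : A.IsHermitian) : cfc (fun x : ℝ => x) A = A :=
  cfc_id' ℝ A hA.isSelfAdjoint

theorem cfc_one_of_isHermitian (hA : A.IsHermitian) : cfc (fun _ : ℝ => (1 : ℝ)) A = 1 :=
  cfc_const_one ℝ A hA.isSelfAdjoint

theorem trace_cfc (hA : A.IsHermitian) (f : ℝ → ℝ) :
    trace (cfc f A) = ∑ i, f (hA.eigenvalues i) := by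
  rw [hA.cfc_eq, IsHermitian.cfc, Unitary.conjStarAlgAut_apply, trace_mul_comm, ← mul_assoc]
  simp [trace_diagonal]

/-- The trace of a function of `A` times a function of `B` is a nonnegative combination of products
of values at the eigenvalues; the weights are the squared inner products of the eigenvectors. Hence
an inequality `∑ f k a * g k b ≥ 0` between numbers implies the trace inequality
`∑ trace (f k A * g k B) ≥ 0`, although `A` and `B` need not commute. -/
theorem exists_trace_cfc_mul_cfc (hA : A.IsHermitian) (hB : B.IsHermitian) :
    ∃ c : ι → ι → ℝ, (∀ i j, 0 ≤ c i j) ∧ ∀ f g : ℝ → ℝ, trace (cfc f A * cfc g B) =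
      ∑ i, ∑ j, c i j * (f (hA.eigenvalues i) * g (hB.eigenvalues j)) := by
  set U : Matrix ι ι ℝ := (hA.eigenvectorUnitary : Matrix ι ι ℝ)
  set V : Matrix ι ι ℝ := (hB.eigenvectorUnitary : Matrix ι ι ℝ)
  refine ⟨fun i j => (star U * V) i j ^ 2, fun i j => sq_nonneg _, fun f g => ?_⟩
  have h1 : trace (cfc f A * cfc g B) =
      trace (diagonal (f ∘ hA.eigenvalues) * ((star U * V) * diagonal (g ∘ hB.eigenvalues) *
        star (star U * V))) := by
    rw [hA.cfc_eq, hB.cfc_eq, IsHermitian.cfc, IsHermitian.cfc, Unitary.conjStarAlgAut_apply,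
      Unitary.conjStarAlgAut_apply]
    simp only [star_mul, star_star, RCLike.ofReal_real_eq_id, Function.id_comp]
    simp only [mul_assoc]
    rw [trace_mul_comm]
    simp only [mul_assoc]
    rfl
  rw [h1]
  simp only [trace, diag_apply, diagonal_mul, mul_apply (M := (star U * V) * _), mul_diagonal,
    star_apply, star_trivial, Finset.mul_sum]
  refine Finset.sum_congr rfl fun i _ => Finset.sum_congr rfl fun j _ => ?_
  simp only [Function.comp]
  ring

/-! ### Inequalities between real numbers -/

/-- Young's inequality for the exponents `p` and `p / (p - 1)`. -/
theorem mul_rpow_mul_le_rpow_add {p : ℝ} (hp : 1 < p) {a b : ℝ} (ha : 0 ≤ a) (hb : 0 ≤ b) :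
    p * (a * b ^ (p - 1)) ≤ a ^ p + (p - 1) * b ^ p := by
  have hp1 : 0 < p - 1 := by linarith
  have h := Real.young_inequality_of_nonneg ha (Real.rpow_nonneg hb (p - 1))
    (Real.HolderConjugate.conjExponent hp)
  rw [← Real.rpow_mul hb, Real.conjExponent, mul_div_cancel₀ _ hp1.ne'] at h
  calc p * (a * b ^ (p - 1)) ≤ p * (a ^ p / p + b ^ p / (p / (p - 1))) := by gcongr
    _ = _ := by field_simp

theorem mul_mul_abs_rpow_le {p : ℝ} (hp : 1 < p) (a b : ℝ) :
    p * (a * (b * |b| ^ (p - 2))) ≤ |a| ^ p + (p - 1) * |b| ^ p := by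
  refine le_trans ?_ (mul_rpow_mul_le_rpow_add hp (abs_nonneg a) (abs_nonneg b))
  rcases eq_or_ne b 0 with rfl | hb
  · simp; positivity
  have : |b| ^ (p - 1) = |b| * |b| ^ (p - 2) := by
    rw [mul_comm, ← Real.rpow_add_one (abs_ne_zero.mpr hb)]; ring_nf
  rw [this]
  gcongr p * ?_
  calc a * (b * |b| ^ (p - 2)) = (a * b) * |b| ^ (p - 2) := by ring
    _ ≤ |a * b| * |b| ^ (p - 2) := by gcongr; exact le_abs_self _
    _ = _ := by rw [abs_mul]; ring

/-- A two-point form of the mean value theorem for `a * |a| ^ r`, whose derivative is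
`(r + 1) * |a| ^ r`; the derivative at an intermediate point is at most the sum of the derivatives
at the end points. -/
theorem sub_mul_sub_mul_abs_rpow_le {r : ℝ} (hr : 0 < r) (a b : ℝ) :
    (a - b) * (a * |a| ^ r - b * |b| ^ r) ≤ (r + 1) * ((a - b) ^ 2 * (|a| ^ r + |b| ^ r)) := by
  have key : ∀ a b : ℝ, 0 ≤ b → b ≤ a →
      (a - b) * (a * |a| ^ r - b * |b| ^ r) ≤ (r + 1) * ((a - b) ^ 2 * (|a| ^ r + |b| ^ r)) := by
    intro a b hb hab
    have ha : 0 ≤ a := hb.trans hab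
    have h := mul_rpow_mul_le_rpow_add (p := r + 1) (by linarith) hb ha
    rw [add_sub_cancel_right, Real.rpow_add_one' hb (by linarith),
      Real.rpow_add_one' ha (by linarith)] at h
    rw [abs_of_nonneg ha, abs_of_nonneg hb]
    have h2 : a * a ^ r - b * b ^ r ≤ (r + 1) * (a - b) * a ^ r := by linarith
    have h3 : 0 ≤ (r + 1) * ((a - b) ^ 2 * b ^ r) := by positivity
    have h4 := mul_le_mul_of_nonneg_left h2 (sub_nonneg.mpr hab)
    linarith
  have key2 : ∀ a b : ℝ, b ≤ a →
      (a - b) * (a * |a| ^ r - b * |b| ^ r) ≤ (r + 1) * ((a - b) ^ 2 * (|a| ^ r + |b| ^ r)) := by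
    intro a b hab
    rcases le_total 0 b with hb | hb
    · exact key a b hb hab
    rcases le_total 0 a with ha | ha
    · have h1 : 0 ≤ |a| ^ r := by positivity
      have h2 : 0 ≤ |b| ^ r := by positivity
      have h3 : a * |a| ^ r - b * |b| ^ r ≤ (a - b) * (|a| ^ r + |b| ^ r) := by nlinarith
      have h4 := mul_le_mul_of_nonneg_left h3 (sub_nonneg.mpr hab)
      have h5 : 0 ≤ r * ((a - b) ^ 2 * (|a| ^ r + |b| ^ r)) := by positivity
      linarith
    · have := key (-b) (-a) (by linarith) (by linarith)
      simp only [abs_neg] at this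
      linarith
  rcases le_total b a with h | h
  · exact key2 a b h
  · have := key2 b a h
    linarith

/-- Young's inequality with the coefficient `1 / 4`, so that the term in `m` can be absorbed. -/
theorem mul_mul_rpow_le_quarter {c s m k : ℝ} (hc : 0 < c) (hs : 0 ≤ s) (hm : 0 ≤ m) (hk : 1 < k) :
    c * (s * m ^ (k - 1)) ≤ 1 / 4 * m ^ k + 1 / 4 * (4 * c) ^ k * s ^ k := by
  have e : ∀ y : ℝ, 0 ≤ y → y ^ k = y * y ^ (k - 1) := by
    intro y hy
    rw [mul_comm, ← Real.rpow_add_one' hy (by linarith), sub_add_cancel]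
  rw [mul_assoc, ← Real.mul_rpow (by positivity) hs, e m hm, e (4 * c * s) (by positivity)]
  have hm' : 0 ≤ m ^ (k - 1) := by positivity
  rcases le_total (4 * c * s) m with h | h
  · have h1 := mul_le_mul_of_nonneg_right h hm'
    have : 0 ≤ 4 * c * s * (4 * c * s) ^ (k - 1) := by positivity
    linarith
  · have h1 : m ^ (k - 1) ≤ (4 * c * s) ^ (k - 1) := Real.rpow_le_rpow hm h (by linarith)
    have h2 := mul_le_mul_of_nonneg_left h1 (by positivity : 0 ≤ c * s)
    have : 0 ≤ m * m ^ (k - 1) := by positivity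
    linarith

/-! ### Trace inequalities for two symmetric matrices -/

/-- The trace of `|X| ^ r` for symmetric `X`: the `r`-th power of its Schatten `r`-norm. -/
noncomputable def tracePow (r : ℝ) (X : Matrix ι ι ℝ) : ℝ := trace (cfc (fun x : ℝ => |x| ^ r) X)

theorem trace_mul_cfc_nonneg (hA : A.PosSemidef) (hB : B.IsHermitian) {g : ℝ → ℝ}
    (hg : ∀ x, 0 ≤ g x) : 0 ≤ trace (A * cfc g B) := by
  obtain ⟨c, hc, h⟩ := exists_trace_cfc_mul_cfc hA.1 hB
  rw [show A * cfc g B = cfc (fun x : ℝ => x) A * cfc g B by rw [cfc_id_of_isHermitian hA.1], h]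
  exact Finset.sum_nonneg fun i _ => Finset.sum_nonneg fun j _ =>
    mul_nonneg (hc i j) (mul_nonneg (hA.eigenvalues_nonneg i) (hg _))

theorem trace_mul_cfc_mul_abs_rpow_nonneg (hA : A.PosSemidef) (hB : B.PosSemidef) (r : ℝ) :
    0 ≤ trace (A * cfc (fun x : ℝ => x * |x| ^ r) B) := by
  obtain ⟨c, hc, h⟩ := exists_trace_cfc_mul_cfc hA.1 hB.1
  rw [show A * cfc (fun x : ℝ => x * |x| ^ r) B =
    cfc (fun x : ℝ => x) A * cfc (fun x : ℝ => x * |x| ^ r) B by rw [cfc_id_of_isHermitian hA.1], h]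
  exact Finset.sum_nonneg fun i _ => Finset.sum_nonneg fun j _ =>
    mul_nonneg (hc i j) (mul_nonneg (hA.eigenvalues_nonneg i)
      (mul_nonneg (hB.eigenvalues_nonneg j) (by positivity)))

theorem tracePow_nonneg (hA : A.IsHermitian) (r : ℝ) : 0 ≤ tracePow r A := by
  rw [tracePow, trace_cfc hA]
  exact Finset.sum_nonneg fun i _ => by positivity

/-- The mean value trace inequality: the expansions of both sides consist of products of a function
of `A` and a function of `B`, so it reduces to the inequality `sub_mul_sub_mul_abs_rpow_le` for
numbers. -/
theorem trace_sub_mul_sub_cfc_le (hA : A.IsHermitian) (hB : B.IsHermitian) {r : ℝ} (hr : 0 < r) :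
    trace ((A - B) * (cfc (fun x : ℝ => x * |x| ^ r) A - cfc (fun x : ℝ => x * |x| ^ r) B)) ≤
      (r + 1) * trace ((A - B) * (A - B) *
        (cfc (fun x : ℝ => |x| ^ r) A + cfc (fun x : ℝ => |x| ^ r) B)) := by
  obtain ⟨c, hc, h⟩ := exists_trace_cfc_mul_cfc hA hB
  let S : (ℝ → ℝ) → (ℝ → ℝ) → ℝ := fun f g =>
    ∑ i, ∑ j, c i j * (f (hA.eigenvalues i) * g (hB.eigenvalues j))
  replace h : ∀ f g : ℝ → ℝ, trace (cfc f A * cfc g B) = S f g := h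
  set F : ℝ → ℝ := fun x => x * |x| ^ r with hF
  set G : ℝ → ℝ := fun x => |x| ^ r with hG
  have i1 := cfc_id_of_isHermitian hA
  have i2 := cfc_id_of_isHermitian hB
  have o1 := cfc_one_of_isHermitian hA
  have o2 := cfc_one_of_isHermitian hB
  have t1 : trace (A * cfc F A) = S (fun x => x * F x) (fun _ => 1) := by
    have := h (fun x => x * F x) (fun _ => 1)
    rwa [o2, mul_one, ← cfc_mul_cfc hA (fun x => x), i1] at this
  have t2 : trace (A * cfc F B) = S (fun x => x) F := by
    have := h (fun x => x) F
    rwa [i1] at this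
  have t3 : trace (B * cfc F A) = S F (fun x => x) := by
    have := h F (fun x => x)
    rwa [i2, trace_mul_comm] at this
  have t4 : trace (B * cfc F B) = S (fun _ => 1) (fun x => x * F x) := by
    have := h (fun _ => 1) (fun x => x * F x)
    rwa [o1, one_mul, ← cfc_mul_cfc hB (fun x => x), i2] at this
  have s1 : trace (A * A * cfc G A) = S (fun x => x * (x * G x)) (fun _ => 1) := by
    have := h (fun x => x * (x * G x)) (fun _ => 1)
    rwa [o2, mul_one, ← cfc_mul_cfc hA (fun x => x), ← cfc_mul_cfc hA (fun x => x), i1,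
      ← mul_assoc] at this
  have s2 : trace (A * B * cfc G A) = S (fun x => G x * x) (fun x => x) := by
    have := h (fun x => G x * x) (fun x => x)
    rwa [i2, ← cfc_mul_cfc hA G (fun x => x), i1, mul_assoc, trace_mul_comm] at this
  have s3 : trace (B * A * cfc G A) = S (fun x => x * G x) (fun x => x) := by
    have := h (fun x => x * G x) (fun x => x)
    rwa [i2, ← cfc_mul_cfc hA (fun x => x), i1, trace_mul_comm, ← mul_assoc] at this
  have s4 : trace (B * B * cfc G A) = S G (fun x => x * x) := by
    have := h G (fun x => x * x)
    rwa [← cfc_mul_cfc hB (fun x => x), i2, trace_mul_comm] at this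
  have s5 : trace (A * A * cfc G B) = S (fun x => x * x) G := by
    have := h (fun x => x * x) G
    rwa [← cfc_mul_cfc hA (fun x => x), i1] at this
  have s6 : trace (A * B * cfc G B) = S (fun x => x) (fun x => x * G x) := by
    have := h (fun x => x) (fun x => x * G x)
    rwa [← cfc_mul_cfc hB (fun x => x), i2, i1, ← mul_assoc] at this
  have s7 : trace (B * A * cfc G B) = S (fun x => x) (fun x => G x * x) := by
    have := h (fun x => x) (fun x => G x * x)
    rwa [← cfc_mul_cfc hB G (fun x => x), i2, i1, ← mul_assoc, trace_mul_comm,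
      ← mul_assoc] at this
  have s8 : trace (B * B * cfc G B) = S (fun _ => 1) (fun x => x * (x * G x)) := by
    have := h (fun _ => 1) (fun x => x * (x * G x))
    rwa [o1, one_mul, ← cfc_mul_cfc hB (fun x => x), ← cfc_mul_cfc hB (fun x => x), i2,
      ← mul_assoc] at this
  simp only [sub_mul, mul_sub, mul_add, trace_sub, trace_add]
  rw [t1, t2, t3, t4, s1, s2, s3, s4, s5, s6, s7, s8]
  simp only [S, Finset.mul_sum, ← Finset.sum_sub_distrib, ← Finset.sum_add_distrib]
  refine Finset.sum_le_sum fun i _ => Finset.sum_le_sum fun j _ => ?_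
  have := mul_le_mul_of_nonneg_left
    (sub_mul_sub_mul_abs_rpow_le hr (hA.eigenvalues i) (hB.eigenvalues j)) (hc i j)
  simp only [hF, hG]
  linarith

/-- This is the subgradient inequality for the convex function `tracePow p`. -/
theorem trace_mul_cfc_le_tracePow (hA : A.IsHermitian) (hB : B.IsHermitian) {p : ℝ} (hp : 1 < p) :
    p * trace (A * cfc (fun x : ℝ => x * |x| ^ (p - 2)) B) ≤
      tracePow p A + (p - 1) * tracePow p B := by
  obtain ⟨c, hc, h⟩ := exists_trace_cfc_mul_cfc hA hB
  have t1 := h (fun x => x) (fun x => x * |x| ^ (p - 2))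
  have t2 := h (fun x => |x| ^ p) (fun _ => 1)
  have t3 := h (fun _ => 1) (fun x => |x| ^ p)
  rw [cfc_id_of_isHermitian hA] at t1
  rw [cfc_one_of_isHermitian hB, mul_one] at t2
  rw [cfc_one_of_isHermitian hA, one_mul] at t3
  rw [tracePow, tracePow, t1, t2, t3]
  simp only [Finset.mul_sum, ← Finset.sum_add_distrib]
  refine Finset.sum_le_sum fun i _ => Finset.sum_le_sum fun j _ => ?_
  have := mul_le_mul_of_nonneg_left
    (mul_mul_abs_rpow_le hp (hA.eigenvalues i) (hB.eigenvalues j)) (hc i j)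
  linarith

theorem mul_trace_mul_cfc_sq_le (hA : A.PosSemidef) (hB : B.IsHermitian) {c k : ℝ}
    (hc : 0 < c) (hk : 1 < k) :
    c * trace (A * cfc (fun x : ℝ => |x| ^ (2 * k - 2)) B) ≤
      1 / 4 * tracePow (2 * k) B + 1 / 4 * (4 * c) ^ k * tracePow k A := by
  obtain ⟨w, hw, h⟩ := exists_trace_cfc_mul_cfc hA.1 hB
  have t1 := h (fun x => x) (fun x => |x| ^ (2 * k - 2))
  have t2 := h (fun x => |x| ^ k) (fun _ => 1)
  have t3 := h (fun _ => 1) (fun x => |x| ^ (2 * k))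
  rw [cfc_id_of_isHermitian hA.1] at t1
  rw [cfc_one_of_isHermitian hB, mul_one] at t2
  rw [cfc_one_of_isHermitian hA.1, one_mul] at t3
  rw [tracePow, tracePow, t1, t2, t3]
  simp only [Finset.mul_sum, ← Finset.sum_add_distrib]
  refine Finset.sum_le_sum fun i _ => Finset.sum_le_sum fun j _ => ?_
  have := mul_le_mul_of_nonneg_left (mul_mul_rpow_le_quarter hc (hA.eigenvalues_nonneg i)
    (sq_nonneg |hB.eigenvalues j|) hk) (hw i j)
  rw [← Real.rpow_natCast_mul (abs_nonneg _), ← Real.rpow_natCast_mul (abs_nonneg _),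
    Nat.cast_ofNat, mul_sub, mul_one] at this
  rw [abs_of_nonneg (hA.eigenvalues_nonneg i)]
  linarith

theorem mul_trace_mul_cfc_le (hA : A.PosSemidef) (hB : B.PosSemidef) {c k : ℝ}
    (hc : 0 < c) (hk : 1 < k) :
    c * trace (A * cfc (fun x : ℝ => x * |x| ^ (k - 2)) B) ≤
      1 / 4 * tracePow k B + 1 / 4 * (4 * c) ^ k * tracePow k A := by
  obtain ⟨w, hw, h⟩ := exists_trace_cfc_mul_cfc hA.1 hB.1
  have t1 := h (fun x => x) (fun x => x * |x| ^ (k - 2))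
  have t2 := h (fun x => |x| ^ k) (fun _ => 1)
  have t3 := h (fun _ => 1) (fun x => |x| ^ k)
  rw [cfc_id_of_isHermitian hA.1] at t1
  rw [cfc_one_of_isHermitian hB.1, mul_one] at t2
  rw [cfc_one_of_isHermitian hA.1, one_mul] at t3
  rw [tracePow, tracePow, t1, t2, t3]
  simp only [Finset.mul_sum, ← Finset.sum_add_distrib]
  refine Finset.sum_le_sum fun i _ => Finset.sum_le_sum fun j _ => ?_
  have hb := hB.eigenvalues_nonneg j
  have := mul_le_mul_of_nonneg_left (mul_mul_rpow_le_quarter hc (hA.eigenvalues_nonneg i)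
    hb hk) (hw i j)
  rw [abs_of_nonneg (hA.eigenvalues_nonneg i), abs_of_nonneg hb]
  have e : hB.1.eigenvalues j * hB.1.eigenvalues j ^ (k - 2) = hB.1.eigenvalues j ^ (k - 1) := by
    rw [mul_comm, ← Real.rpow_add_one' hb (by linarith)]; ring_nf
  rw [e]
  linarith

theorem mul_trace_mul_mul_cfc_le (hA : A.PosSemidef) (hB : B.PosSemidef) {c k : ℝ}
    (hc : 0 < c) (hk : 2 < k) :
    c * trace (A * A * cfc (fun x : ℝ => |x| ^ (k - 2)) B) ≤
      1 / 4 * trace (A * cfc (fun x : ℝ => x * |x| ^ (k - 2)) B) +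
        1 / 4 * (4 * c) ^ (k - 1) * tracePow k A := by
  obtain ⟨w, hw, h⟩ := exists_trace_cfc_mul_cfc hA.1 hB.1
  have t1 := h (fun x => x * x) (fun x => |x| ^ (k - 2))
  have t2 := h (fun x => x) (fun x => x * |x| ^ (k - 2))
  have t3 := h (fun x => |x| ^ k) (fun _ => 1)
  rw [← cfc_mul_cfc hA.1 (fun x => x), cfc_id_of_isHermitian hA.1] at t1
  rw [cfc_id_of_isHermitian hA.1] at t2
  rw [cfc_one_of_isHermitian hB.1, mul_one] at t3
  rw [tracePow, t1, t2, t3]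
  simp only [Finset.mul_sum, ← Finset.sum_add_distrib]
  refine Finset.sum_le_sum fun i _ => Finset.sum_le_sum fun j _ => ?_
  have ha := hA.eigenvalues_nonneg i
  have hb := hB.eigenvalues_nonneg j
  have := mul_le_mul_of_nonneg_left (mul_le_mul_of_nonneg_left
    (mul_mul_rpow_le_quarter (k := k - 1) hc ha hb (by linarith)) ha) (hw i j)
  rw [abs_of_nonneg ha, abs_of_nonneg hb]
  have e : hB.1.eigenvalues j * hB.1.eigenvalues j ^ (k - 2) = hB.1.eigenvalues j ^ (k - 1) := by
    rw [mul_comm, ← Real.rpow_add_one' hb (by linarith)]; ring_nf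
  have e2 : hA.1.eigenvalues i ^ k = hA.1.eigenvalues i * hA.1.eigenvalues i ^ (k - 1) := by
    rw [mul_comm, ← Real.rpow_add_one' ha (by linarith), sub_add_cancel]
  rw [e, e2]
  rw [show k - 1 - 1 = k - 2 by ring] at this
  linarith

theorem trace_mul_self_cfc (hA : A.IsHermitian) {p : ℝ} (hp : 0 < p) :
    trace (A * cfc (fun x : ℝ => x * |x| ^ (p - 2)) A) = tracePow p A := by
  rw [show A * cfc (fun x : ℝ => x * |x| ^ (p - 2)) A =
    cfc (fun x : ℝ => x) A * cfc (fun x : ℝ => x * |x| ^ (p - 2)) A by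
      rw [cfc_id_of_isHermitian hA], cfc_mul_cfc hA, tracePow]
  congr 2
  ext x
  rcases eq_or_ne x 0 with rfl | hx
  · simp [Real.zero_rpow hp.ne']
  · rw [← mul_assoc, ← abs_mul_abs_self, ← pow_two, ← Real.rpow_natCast,
      ← Real.rpow_add (abs_pos.mpr hx)]
    norm_num

end cfc

/-! ### Resampling one coordinate -/

section resampling
variable {Ω : Type*} [MeasurableSpace Ω] {P : Measure Ω} [IsProbabilityMeasure P] {n : ℕ}
  {x : Fin n → Ω → ℝ} {L : ℝ}

/-- Bounded variables take values in a compact cube, on which continuous functions are bounded. -/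
theorem integrable_continuous_comp {Ω' : Type*} [MeasurableSpace Ω'] {Q : Measure Ω'}
    [IsFiniteMeasure Q] {m : Type*} [Fintype m] {y : m → Ω' → ℝ} (hy : ∀ i, Measurable (y i))
    (hb : ∀ i, ∀ᵐ ω ∂Q, |y i ω| ≤ L) {G : (m → ℝ) → ℝ} (hG : Continuous G) :
    Integrable (fun ω => G fun i => y i ω) Q := by
  obtain ⟨C, hC⟩ := (isCompact_univ_pi fun _ : m => isCompact_Icc (a := -L) (b := L))
    |>.exists_bound_of_continuousOn hG.continuousOn
  refine Integrable.of_bound (C := C)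
    (hG.measurable.comp (measurable_pi_lambda _ hy)).aestronglyMeasurable ?_
  filter_upwards [ae_all_iff.mpr hb] with ω hω
  exact hC _ fun i _ => abs_le.mp (hω i)

theorem integrable_continuous_comp_one {ξ : Ω → ℝ} (hξ : Measurable ξ)
    (hb : ∀ᵐ ω ∂P, |ξ ω| ≤ L) {G : ℝ → ℝ} (hG : Continuous G) :
    Integrable (fun ω => G (ξ ω)) P :=
  integrable_continuous_comp (m := Unit) (y := fun _ => ξ) (fun _ => hξ) (fun _ => hb)
    (G := fun y => G (y ())) (by fun_prop)

theorem integrable_continuous_comp_prod (hmeas : ∀ i, Measurable (x i))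
    (hb : ∀ i, ∀ᵐ ω ∂P, |x i ω| ≤ L) {G : (Fin n → ℝ) → (Fin n → ℝ) → ℝ}
    (hG : Continuous fun z : (Fin n → ℝ) × (Fin n → ℝ) => G z.1 z.2) :
    Integrable (fun z : Ω × Ω => G (fun i => x i z.1) fun i => x i z.2) (P.prod P) :=
  integrable_continuous_comp (L := L) (m := Fin n ⊕ Fin n)
    (y := Sum.elim (fun i (z : Ω × Ω) => x i z.1) fun i (z : Ω × Ω) => x i z.2)
    (by rintro (i | i) <;> simp only [Sum.elim_inl, Sum.elim_inr] <;> fun_prop)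
    (by
      rintro (i | i)
      · exact Measure.quasiMeasurePreserving_fst.ae (hb i)
      · exact Measure.quasiMeasurePreserving_snd.ae (hb i))
    (G := fun y => G (fun i => y (.inl i)) fun i => y (.inr i))
    (hG.comp (f := fun y : Fin n ⊕ Fin n → ℝ => ((fun i => y (.inl i)), fun i => y (.inr i)))
      (by fun_prop))

/-- The vector `y` with the coordinates outside `S` set to `0`. -/
def mask (S : Finset (Fin n)) (y : Fin n → ℝ) : Fin n → ℝ := fun i => if i ∈ S then y i else 0

theorem continuous_mask (S : Finset (Fin n)) : Continuous (mask S) := by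
  refine continuous_pi fun i => ?_
  unfold mask
  split_ifs <;> fun_prop

/-- The coordinates in `S` and those outside `S` are independent, so that the latter may be
replaced by an independent copy. -/
theorem integral_mask_mask_compl (hmeas : ∀ i, Measurable (x i)) (hindep : iIndepFun x P)
    (hb : ∀ i, ∀ᵐ ω ∂P, |x i ω| ≤ L) (S : Finset (Fin n))
    {G : (Fin n → ℝ) → (Fin n → ℝ) → ℝ}
    (hG : Continuous fun z : (Fin n → ℝ) × (Fin n → ℝ) => G z.1 z.2) :
    ∫ ω, G (mask S fun i => x i ω) (mask Sᶜ fun i => x i ω) ∂P =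
      ∫ ω, ∫ ω', G (mask S fun i => x i ω) (mask Sᶜ fun i => x i ω') ∂P ∂P := by
  have hX : Measurable fun ω i => x i ω := measurable_pi_lambda _ hmeas
  set U : Ω → Fin n → ℝ := fun ω => mask S fun i => x i ω with hU
  set V : Ω → Fin n → ℝ := fun ω => mask Sᶜ fun i => x i ω with hV
  have mU : Measurable U := (continuous_mask S).measurable.comp hX
  have mV : Measurable V := (continuous_mask Sᶜ).measurable.comp hX
  have hUV : IndepFun U V P := by
    have h := hindep.indepFun_finset S Sᶜ disjoint_compl_right hmeas
    have ext_meas : ∀ T : Finset (Fin n), Measurable fun (y : T → ℝ) (i : Fin n) =>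
        if hi : i ∈ T then y ⟨i, hi⟩ else 0 := by
      intro T
      refine measurable_pi_lambda _ fun i => ?_
      split_ifs <;> fun_prop
    have h2 := h.comp (ext_meas S) (ext_meas Sᶜ)
    have e : ∀ T : Finset (Fin n), ((fun (y : T → ℝ) (i : Fin n) =>
        if hi : i ∈ T then y ⟨i, hi⟩ else 0) ∘ fun a (i : T) => x i a) =
          fun ω => mask T fun i => x i ω := by
      intro T
      ext ω i
      simp [mask]
    rwa [e, e] at h2
  have hmap := (indepFun_iff_map_prod_eq_prod_map_map mU.aemeasurable mV.aemeasurable).mp hUV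
  rw [Measure.map_prod_map P P mU mV] at hmap
  have hGs : StronglyMeasurable fun z : (Fin n → ℝ) × (Fin n → ℝ) => G z.1 z.2 :=
    hG.stronglyMeasurable
  have h1 := integral_map (μ := P) (mU.prodMk mV).aemeasurable
    (f := fun z : (Fin n → ℝ) × (Fin n → ℝ) => G z.1 z.2) hGs.aestronglyMeasurable
  have h2 := integral_map (μ := P.prod P) (mU.prodMap mV).aemeasurable
    (f := fun z : (Fin n → ℝ) × (Fin n → ℝ) => G z.1 z.2) hGs.aestronglyMeasurable
  rw [hmap, h2] at h1
  rw [← h1, integral_prod]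
  · rfl
  · exact integrable_continuous_comp_prod hmeas hb (G := fun y z => G (mask S y) (mask Sᶜ z))
      (hG.comp (((continuous_mask S).comp continuous_fst).prodMk
        ((continuous_mask Sᶜ).comp continuous_snd)))

/-- One coordinate may be resampled without changing the expectation. -/
theorem integral_eq_integral_integral_update (hmeas : ∀ i, Measurable (x i))
    (hindep : iIndepFun x P) (hb : ∀ i, ∀ᵐ ω ∂P, |x i ω| ≤ L) (i : Fin n)
    {G : (Fin n → ℝ) → ℝ} (hG : Continuous G) :
    ∫ ω, G (fun j => x j ω) ∂P =
      ∫ ω, ∫ ω', G (Function.update (fun j => x j ω) i (x i ω')) ∂P ∂P := by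
  have h := integral_mask_mask_compl hmeas hindep hb {i}ᶜ (G := fun y z => G (y + z))
    (by fun_prop)
  have e : ∀ y z : Fin n → ℝ, mask {i}ᶜ y + mask ({i}ᶜ)ᶜ z = Function.update y i (z i) := by
    intro y z
    ext j
    by_cases hj : j = i
    · subst hj; simp [mask]
    · simp [mask, hj]
  simpa only [e, Function.update_eq_self] using h

/-- A covariance bound: for an independent copy `η` of `ξ`, the expectation of
`(ζ ξ - ζ η) * (φ ξ - φ η)` is twice the covariance of `ζ ξ` and `φ ξ`, and by symmetry the
expectation of `(ζ ξ - ζ η) ^ 2 * (ψ ξ + ψ η)` is twice that of `(ζ ξ - ζ η) ^ 2 * ψ ξ`. The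
left-hand side of `hwζ` is the conditional expectation of `(ζ ξ - ζ η) ^ 2` given `ξ`. -/
theorem integral_mul_le_of_sub_mul_sub_le {ξ : Ω → ℝ} (hξ : Measurable ξ)
    (hb : ∀ᵐ ω ∂P, |ξ ω| ≤ L) {ζ w φ ψ : ℝ → ℝ} (hζ : Continuous ζ) (hw : Continuous w)
    (hφ : Continuous φ) (hψ : Continuous ψ) (hψ0 : ∀ a, 0 ≤ ψ a)
    (h : ∀ a b, (ζ a - ζ b) * (φ a - φ b) ≤ (ζ a - ζ b) ^ 2 * (ψ a + ψ b))
    (hwζ : ∀ᵐ ω ∂P, ζ (ξ ω) ^ 2 - 2 * (∫ ω', ζ (ξ ω') ∂P) * ζ (ξ ω) + ∫ ω', ζ (ξ ω') ^ 2 ∂P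
      ≤ w (ξ ω)) :
    ∫ ω, ζ (ξ ω) * φ (ξ ω) ∂P ≤
      (∫ ω, ζ (ξ ω) ∂P) * ∫ ω, φ (ξ ω) ∂P + ∫ ω, w (ξ ω) * ψ (ξ ω) ∂P := by
  have I : ∀ {G : ℝ → ℝ}, Continuous G → Integrable (fun ω => G (ξ ω)) P :=
    fun hG => integrable_continuous_comp_one hξ hb hG
  set m := ∫ ω, ζ (ξ ω) ∂P with d_m
  set m2 := ∫ ω, ζ (ξ ω) ^ 2 ∂P with d_m2
  set f := ∫ ω, φ (ξ ω) ∂P with d_f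
  set zf := ∫ ω, ζ (ξ ω) * φ (ξ ω) ∂P with d_zf
  set s := ∫ ω, ψ (ξ ω) ∂P with d_s
  set zs := ∫ ω, ζ (ξ ω) * ψ (ξ ω) ∂P with d_zs
  set zzs := ∫ ω, ζ (ξ ω) ^ 2 * ψ (ξ ω) ∂P with d_zzs
  clear_value m m2 f zf s zs zzs
  -- The hypothesis `h` with `b = ξ ω`, integrated over `ω`.
  have inner : ∀ a, ζ a * φ a - ζ a * f - φ a * m + zf ≤
      (ζ a ^ 2 - 2 * ζ a * m + m2) * ψ a + (ζ a ^ 2 * s - 2 * ζ a * zs + zzs) := by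
    intro a
    have l : ∫ ω, (ζ a * φ a - ζ a * φ (ξ ω) - φ a * ζ (ξ ω) + ζ (ξ ω) * φ (ξ ω)) ∂P =
        ζ a * φ a - ζ a * f - φ a * m + zf := by
      rw [integral_add (I (G := fun b => ζ a * φ a - ζ a * φ b - φ a * ζ b) (by fun_prop))
        (I (G := fun b => ζ b * φ b) (by fun_prop)),
        integral_sub (I (G := fun b => ζ a * φ a - ζ a * φ b) (by fun_prop))
        (I (G := fun b => φ a * ζ b) (by fun_prop)),
        integral_sub (I (G := fun b => ζ a * φ a) (by fun_prop))
        (I (G := fun b => ζ a * φ b) (by fun_prop)), integral_const_mul, integral_const_mul]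
      simp [d_f, d_m, d_zf, integral_const_mul]
    have r : ∫ ω, ((ζ a ^ 2 - 2 * ζ a * ζ (ξ ω) + ζ (ξ ω) ^ 2) * ψ a +
        (ζ a ^ 2 * ψ (ξ ω) - 2 * ζ a * (ζ (ξ ω) * ψ (ξ ω)) + ζ (ξ ω) ^ 2 * ψ (ξ ω))) ∂P =
        (ζ a ^ 2 - 2 * ζ a * m + m2) * ψ a + (ζ a ^ 2 * s - 2 * ζ a * zs + zzs) := by
      rw [integral_add (I (G := fun b => (ζ a ^ 2 - 2 * ζ a * ζ b + ζ b ^ 2) * ψ a) (by fun_prop))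
        (I (G := fun b => ζ a ^ 2 * ψ b - 2 * ζ a * (ζ b * ψ b) + ζ b ^ 2 * ψ b) (by fun_prop)),
        integral_mul_const,
        integral_add (I (G := fun b => ζ a ^ 2 - 2 * ζ a * ζ b) (by fun_prop))
        (I (G := fun b => ζ b ^ 2) (by fun_prop)),
        integral_sub (I (G := fun b => ζ a ^ 2) (by fun_prop))
        (I (G := fun b => 2 * ζ a * ζ b) (by fun_prop)),
        integral_add (I (G := fun b => ζ a ^ 2 * ψ b - 2 * ζ a * (ζ b * ψ b)) (by fun_prop))
        (I (G := fun b => ζ b ^ 2 * ψ b) (by fun_prop)),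
        integral_sub (I (G := fun b => ζ a ^ 2 * ψ b) (by fun_prop))
        (I (G := fun b => 2 * ζ a * (ζ b * ψ b)) (by fun_prop)), integral_const_mul,
        integral_const_mul, integral_const_mul]
      simp [d_m, d_m2, d_s, d_zs, d_zzs]
    rw [← l, ← r]
    refine integral_mono (I (G := fun b => ζ a * φ a - ζ a * φ b - φ a * ζ b + ζ b * φ b)
      (by fun_prop)) (I (G := fun b => (ζ a ^ 2 - 2 * ζ a * ζ b + ζ b ^ 2) * ψ a +
        (ζ a ^ 2 * ψ b - 2 * ζ a * (ζ b * ψ b) + ζ b ^ 2 * ψ b)) (by fun_prop)) fun ω => ?_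
    have := h a (ξ ω)
    dsimp only
    linarith
  have l : ∫ ω, (ζ (ξ ω) * φ (ξ ω) - ζ (ξ ω) * f - φ (ξ ω) * m + zf) ∂P =
      zf - m * f - f * m + zf := by
    rw [integral_add (I (G := fun b => ζ b * φ b - ζ b * f - φ b * m) (by fun_prop))
      (I (G := fun b => zf) (by fun_prop)),
      integral_sub (I (G := fun b => ζ b * φ b - ζ b * f) (by fun_prop))
      (I (G := fun b => φ b * m) (by fun_prop)),
      integral_sub (I (G := fun b => ζ b * φ b) (by fun_prop))
      (I (G := fun b => ζ b * f) (by fun_prop)), integral_mul_const, integral_mul_const]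
    simp [d_f, d_m, d_zf]
  have eV : ∫ ω, (ζ (ξ ω) ^ 2 - 2 * m * ζ (ξ ω) + m2) * ψ (ξ ω) ∂P =
      zzs - 2 * m * zs + m2 * s := by
    rw [d_zzs, d_zs, d_s, ← integral_const_mul, ← integral_const_mul, ← integral_sub
      (I (G := fun b => ζ b ^ 2 * ψ b) (by fun_prop))
      (I (G := fun b => 2 * m * (ζ b * ψ b)) (by fun_prop)), ← integral_add
      (I (G := fun b => ζ b ^ 2 * ψ b - 2 * m * (ζ b * ψ b)) (by fun_prop))
      (I (G := fun b => m2 * ψ b) (by fun_prop))]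
    congr 1
    ext ω
    ring
  have r : ∫ ω, ((ζ (ξ ω) ^ 2 - 2 * ζ (ξ ω) * m + m2) * ψ (ξ ω) +
      (ζ (ξ ω) ^ 2 * s - 2 * ζ (ξ ω) * zs + zzs)) ∂P = 2 * (zzs - 2 * m * zs + m2 * s) := by
    rw [integral_add (I (G := fun b => (ζ b ^ 2 - 2 * ζ b * m + m2) * ψ b) (by fun_prop))
      (I (G := fun b => ζ b ^ 2 * s - 2 * ζ b * zs + zzs) (by fun_prop)),
      integral_add (I (G := fun b => ζ b ^ 2 * s - 2 * ζ b * zs) (by fun_prop))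
      (I (G := fun b => zzs) (by fun_prop)),
      integral_sub (I (G := fun b => ζ b ^ 2 * s) (by fun_prop))
      (I (G := fun b => 2 * ζ b * zs) (by fun_prop)), integral_mul_const, integral_mul_const,
      integral_const_mul, integral_const]
    have : ∫ ω, (ζ (ξ ω) ^ 2 - 2 * ζ (ξ ω) * m + m2) * ψ (ξ ω) ∂P =
        zzs - 2 * m * zs + m2 * s := by
      rw [← eV]
      congr 1
      ext ω
      ring
    rw [this]
    simp only [probReal_univ, one_smul, ← d_m, ← d_m2]
    ring
  -- Integration over the first point as well.
  have outer := integral_mono (μ := P)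
    (I (G := fun a => ζ a * φ a - ζ a * f - φ a * m + zf) (by fun_prop))
    (I (G := fun a => (ζ a ^ 2 - 2 * ζ a * m + m2) * ψ a + (ζ a ^ 2 * s - 2 * ζ a * zs + zzs))
      (by fun_prop)) (fun ω => inner (ξ ω))
  rw [l, r] at outer
  have hV : ∫ ω, (ζ (ξ ω) ^ 2 - 2 * m * ζ (ξ ω) + m2) * ψ (ξ ω) ∂P ≤
      ∫ ω, w (ξ ω) * ψ (ξ ω) ∂P := by
    refine integral_mono_ae (I (G := fun a => (ζ a ^ 2 - 2 * m * ζ a + m2) * ψ a) (by fun_prop))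
      (I (G := fun a => w a * ψ a) (by fun_prop)) ?_
    filter_upwards [hwζ] with ω hω
    exact mul_le_mul_of_nonneg_right hω (hψ0 _)
  rw [eV] at hV
  linarith

/-- The covariance bound `integral_mul_le_of_sub_mul_sub_le`, applied to one coordinate with the
other coordinates held fixed. -/
theorem integral_coord_mul_le (hmeas : ∀ i, Measurable (x i))
    (hindep : iIndepFun x P) (hb : ∀ i, ∀ᵐ ω ∂P, |x i ω| ≤ L) (i : Fin n) {ζ w : ℝ → ℝ}
    {Φ Ψ : (Fin n → ℝ) → ℝ} (hζ : Continuous ζ) (hw : Continuous w)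
    (hΦ : Continuous Φ) (hΨ : Continuous Ψ) (hΨ0 : ∀ y, 0 ≤ Ψ y)
    (h : ∀ (y : Fin n → ℝ) (a b : ℝ),
      (ζ a - ζ b) * (Φ (Function.update y i a) - Φ (Function.update y i b)) ≤
        (ζ a - ζ b) ^ 2 * (Ψ (Function.update y i a) + Ψ (Function.update y i b)))
    (hwζ : ∀ᵐ ω ∂P, ζ (x i ω) ^ 2 - 2 * (∫ ω', ζ (x i ω') ∂P) * ζ (x i ω) +
      ∫ ω', ζ (x i ω') ^ 2 ∂P ≤ w (x i ω)) :
    ∫ ω, ζ (x i ω) * Φ (fun j => x j ω) ∂P ≤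
      (∫ ω, ζ (x i ω) ∂P) * ∫ ω, Φ (fun j => x j ω) ∂P +
        ∫ ω, w (x i ω) * Ψ (fun j => x j ω) ∂P := by
  have R := fun {G : (Fin n → ℝ) → ℝ} (hG : Continuous G) =>
    integral_eq_integral_integral_update hmeas hindep hb i hG
  have I : ∀ {G : (Fin n → ℝ) → ℝ}, Continuous G →
      Integrable (fun ω => ∫ ω', G (Function.update (fun j => x j ω) i (x i ω')) ∂P) P := by
    intro G hG
    exact Integrable.integral_prod_left (integrable_continuous_comp_prod hmeas hb
      (G := fun y z => G (Function.update y i (z i)))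
      (hG.comp (continuous_fst.update i ((continuous_apply i).comp continuous_snd))))
  have c1 : Continuous fun y : Fin n → ℝ => ζ (y i) * Φ y := by fun_prop
  have c2 : Continuous fun y : Fin n → ℝ => w (y i) * Ψ y := by fun_prop
  rw [R c1, R hΦ, R c2, ← integral_const_mul, ← integral_add ((I hΦ).const_mul _) (I c2)]
  refine integral_mono (I c1) (((I hΦ).const_mul _).add (I c2)) fun ω => ?_
  simp only [Function.update_self]
  have cu : Continuous fun a => Function.update (fun j => x j ω) i a := by fun_prop
  exact integral_mul_le_of_sub_mul_sub_le (hmeas i) (hb i) hζ hw (hΦ.comp cu) (hΨ.comp cu)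
    (fun a => hΨ0 _) (fun a b => h _ a b) hwζ

end resampling

/-! ### Linear combinations of symmetric matrices -/

section linComb
variable {n : ℕ} {κ : Type*} {H : Fin n → Matrix κ κ ℝ}

/-- The linear combination `∑ i, y i • H i`. -/
def linComb (H : Fin n → Matrix κ κ ℝ) (y : Fin n → ℝ) : Matrix κ κ ℝ := ∑ i, y i • H i

theorem continuous_linComb : Continuous (linComb H) := by
  unfold linComb
  fun_prop

theorem linComb_isHermitian (hH : ∀ i, (H i).IsHermitian) (y : Fin n → ℝ) :
    (linComb H y).IsHermitian := by
  rw [IsHermitian, linComb, conjTranspose_sum]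
  exact Finset.sum_congr rfl fun i _ => by rw [conjTranspose_smul, (hH i).eq, star_trivial]

theorem linComb_update_sub (y : Fin n → ℝ) (i : Fin n) (a b : ℝ) :
    linComb H (Function.update y i a) - linComb H (Function.update y i b) = (a - b) • H i := by
  rw [linComb, linComb, ← Finset.sum_sub_distrib, Finset.sum_eq_single i]
  · simp [sub_smul]
  · intro j _ hj
    simp [hj]
  · simp

theorem linComb_posSemidef (hH : ∀ i, (H i).PosSemidef) {y : Fin n → ℝ} (hy : ∀ i, 0 ≤ y i) :
    (linComb H y).PosSemidef :=
  posSemidef_sum _ fun i _ => (hH i).smul (hy i)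

theorem update_sq (y : Fin n → ℝ) (i : Fin n) (a : ℝ) :
    (fun j => Function.update y i a j ^ 2) = Function.update (fun j => y j ^ 2) i (a ^ 2) := by
  ext j
  by_cases hj : j = i
  · subst hj; simp
  · simp [hj]

theorem trace_linComb_mul [Fintype κ] (y : Fin n → ℝ) (M : Matrix κ κ ℝ) :
    trace (linComb H y * M) = ∑ i, y i * trace (H i * M) := by
  simp [linComb, Finset.sum_mul, trace_sum]

theorem mul_self_posSemidef [Fintype κ] {M : Matrix κ κ ℝ} (hM : M.IsHermitian) :
    (M * M).PosSemidef := by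
  have := posSemidef_conjTranspose_mul_self M
  rwa [hM.eq] at this

end linComb

section symmetric
variable {Ω : Type*} [MeasurableSpace Ω] {P : Measure Ω} [IsProbabilityMeasure P] {n : ℕ}
  {x : Fin n → Ω → ℝ} {L : ℝ} {κ : Type*} [Fintype κ] [DecidableEq κ]
  {H : Fin n → Matrix κ κ ℝ}

theorem continuous_trace_mul_cfc {T : Type*} [TopologicalSpace T] {g : ℝ → ℝ} (hg : Continuous g)
    {M X : T → Matrix κ κ ℝ} (hM : Continuous M) (hX : Continuous X)
    (hs : ∀ y, (X y).IsHermitian) : Continuous fun y => trace (M y * cfc g (X y)) :=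
  (hM.mul (continuous_cfc_of_isHermitian hg hX hs)).matrix_trace

theorem continuous_abs_rpow {r : ℝ} (hr : 0 ≤ r) : Continuous fun x : ℝ => |x| ^ r :=
  continuous_abs.rpow_const fun _ => Or.inr hr

theorem continuous_mul_abs_rpow {r : ℝ} (hr : 0 ≤ r) : Continuous fun x : ℝ => x * |x| ^ r :=
  continuous_id.mul (continuous_abs_rpow hr)

theorem continuous_tracePow {T : Type*} [TopologicalSpace T] {r : ℝ} (hr : 0 ≤ r)
    {X : T → Matrix κ κ ℝ} (hX : Continuous X)
    (hs : ∀ y, (X y).IsHermitian) : Continuous fun y => tracePow r (X y) :=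
  (continuous_cfc_of_isHermitian (continuous_abs_rpow hr) hX hs).matrix_trace

/-- The mean value trace inequality along a single coordinate of a linear combination. -/
theorem sub_mul_trace_sub_le (hH : ∀ i, (H i).IsHermitian) {r : ℝ} (hr : 0 < r) (y : Fin n → ℝ)
    (i : Fin n) (a b : ℝ) :
    (a - b) * (trace (H i * cfc (fun x : ℝ => x * |x| ^ r) (linComb H (Function.update y i a))) -
      trace (H i * cfc (fun x : ℝ => x * |x| ^ r) (linComb H (Function.update y i b)))) ≤
    (a - b) ^ 2 *
      ((r + 1) * trace (H i * H i * cfc (fun x : ℝ => |x| ^ r) (linComb H (Function.update y i a)))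
      + (r + 1) *
        trace (H i * H i * cfc (fun x : ℝ => |x| ^ r) (linComb H (Function.update y i b)))) := by
  have h := trace_sub_mul_sub_cfc_le (linComb_isHermitian hH (Function.update y i a))
    (linComb_isHermitian hH (Function.update y i b)) hr
  rw [linComb_update_sub] at h
  simp only [smul_mul_assoc, mul_smul_comm, trace_smul, mul_sub, mul_add, trace_sub, trace_add,
    smul_eq_mul] at h ⊢
  linarith

/-- Moments of `X = ∑ x i • H i` are controlled by those of `S = ∑ x i ^ 2 • H i ^ 2`. The
covariance bound, applied to each term of
`trace (X * X |X| ^ (2 * q - 2)) = ∑ x i * trace (H i * X |X| ^ (2 * q - 2))`, bounds the moment by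
a multiple of the expectation of `trace ((S + ∑ H i ^ 2) * |X| ^ (2 * q - 2))`; Young's inequality
separates the factors. -/
theorem integral_tracePow_le_of_sq (hmeas : ∀ i, Measurable (x i)) (hindep : iIndepFun x P)
    (hb : ∀ i, ∀ᵐ ω ∂P, |x i ω| ≤ L) (hmean : ∀ i, ∫ ω, x i ω ∂P = 0)
    (hvar : ∀ i, ∫ ω, x i ω ^ 2 ∂P ≤ 1) (hH : ∀ i, (H i).IsHermitian) {q : ℝ} (hq : 1 < q) :
    ∫ ω, tracePow (2 * q) (linComb H fun i => x i ω) ∂P ≤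
      1 / 2 * (4 * (2 * q - 1)) ^ q * (tracePow q (∑ i, H i * H i) +
        ∫ ω, tracePow q (linComb (fun i => H i * H i) fun i => x i ω ^ 2) ∂P) := by
  set X := fun ω => linComb H fun i => x i ω with hX
  set g : ℝ → ℝ := fun x => |x| ^ (2 * q - 2) with hg
  set f : ℝ → ℝ := fun x => x * |x| ^ (2 * q - 2) with hf
  have cg : Continuous g := continuous_abs_rpow (by linarith)
  have cf : Continuous f := continuous_mul_abs_rpow (by linarith)
  have hY := linComb_isHermitian hH
  have hY2 := fun y : Fin n → ℝ => linComb_isHermitian (H := fun i => H i * H i)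
    (fun i => (mul_self_posSemidef (hH i)).1) fun i => y i ^ 2
  have c2 : Continuous fun y : Fin n → ℝ => linComb (fun i => H i * H i) fun i => y i ^ 2 :=
    continuous_linComb.comp (by fun_prop)
  have I : ∀ {G : (Fin n → ℝ) → ℝ}, Continuous G → Integrable (fun ω => G fun i => x i ω) P :=
    fun hG => integrable_continuous_comp hmeas hb hG
  have cΦ : ∀ i, Continuous fun y => trace (H i * cfc f (linComb H y)) := fun i =>
    continuous_trace_mul_cfc cf continuous_const continuous_linComb hY
  have cΨ : ∀ i, Continuous fun y => (2 * q - 2 + 1) * trace (H i * H i * cfc g (linComb H y)) :=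
    fun i => (continuous_trace_mul_cfc cg continuous_const continuous_linComb hY).const_mul _
  have s1 : ∫ ω, tracePow (2 * q) (X ω) ∂P =
      ∑ i, ∫ ω, x i ω * trace (H i * cfc f (X ω)) ∂P := by
    rw [← integral_finsetSum _ fun i _ => I (G := fun y => y i *
      trace (H i * cfc f (linComb H y))) ((continuous_apply i).mul (cΦ i))]
    refine integral_congr_ae (Filter.Eventually.of_forall fun ω => ?_)
    simp only
    rw [← trace_linComb_mul, ← trace_mul_self_cfc (hY _) (by linarith)]
  have s2 : ∀ i, ∫ ω, x i ω * trace (H i * cfc f (X ω)) ∂P ≤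
      ∫ ω, (x i ω ^ 2 + 1) * ((2 * q - 2 + 1) * trace (H i * H i * cfc g (X ω))) ∂P := by
    intro i
    have := integral_coord_mul_le hmeas hindep hb i (ζ := fun a => a) (w := fun a => a ^ 2 + 1)
      continuous_id (by fun_prop) (cΦ i) (cΨ i)
      (fun y => mul_nonneg (by linarith)
        (trace_mul_cfc_nonneg (mul_self_posSemidef (hH i)) (hY y) fun _ => by positivity))
      (fun y a b => sub_mul_trace_sub_le hH (by linarith) y i a b)
      (Filter.Eventually.of_forall fun ω => by rw [hmean i]; linarith [hvar i])
    rwa [hmean i, zero_mul, zero_add] at this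
  have s3 : ∫ ω, tracePow (2 * q) (X ω) ∂P ≤
      ∫ ω, ((2 * q - 1) * trace (linComb (fun i => H i * H i) (fun i => x i ω ^ 2) *
        cfc g (X ω)) + (2 * q - 1) * trace ((∑ i, H i * H i) * cfc g (X ω))) ∂P := by
    rw [s1]
    refine (Finset.sum_le_sum fun i _ => s2 i).trans_eq ?_
    rw [← integral_finsetSum _ fun i _ => I (G := fun y => (y i ^ 2 + 1) *
      ((2 * q - 2 + 1) * trace (H i * H i * cfc g (linComb H y))))
        ((by fun_prop : Continuous fun y : Fin n → ℝ => y i ^ 2 + 1).mul (cΨ i))]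
    refine integral_congr_ae (Filter.Eventually.of_forall fun ω => ?_)
    simp only
    rw [trace_linComb_mul, Finset.sum_mul, trace_sum, Finset.mul_sum, Finset.mul_sum,
      ← Finset.sum_add_distrib]
    exact Finset.sum_congr rfl fun i _ => by ring
  have cX : Continuous fun y => tracePow (2 * q) (linComb H y) :=
    continuous_tracePow (by linarith) continuous_linComb hY
  have cS : Continuous fun y : Fin n → ℝ =>
      tracePow q (linComb (fun i => H i * H i) fun i => y i ^ 2) :=
    continuous_tracePow (by linarith) c2 hY2
  -- Young's inequality; half of the left-hand side reappears on the right and is absorbed.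
  have s4 : ∫ ω, tracePow (2 * q) (X ω) ∂P ≤
      ∫ ω, (1 / 2 * tracePow (2 * q) (X ω) + 1 / 4 * (4 * (2 * q - 1)) ^ q *
        (tracePow q (∑ i, H i * H i) +
          tracePow q (linComb (fun i => H i * H i) fun i => x i ω ^ 2))) ∂P := by
    refine s3.trans (integral_mono (I (G := fun y => (2 * q - 1) *
      trace (linComb (fun i => H i * H i) (fun i => y i ^ 2) * cfc g (linComb H y)) +
      (2 * q - 1) * trace ((∑ i, H i * H i) * cfc g (linComb H y)))
      (((continuous_trace_mul_cfc cg c2 continuous_linComb hY).const_mul _).add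
        ((continuous_trace_mul_cfc cg continuous_const continuous_linComb hY).const_mul _)))
      (I (G := fun y => 1 / 2 * tracePow (2 * q) (linComb H y) + 1 / 4 * (4 * (2 * q - 1)) ^ q *
        (tracePow q (∑ i, H i * H i) +
          tracePow q (linComb (fun i => H i * H i) fun i => y i ^ 2)))
      (by fun_prop)) fun ω => ?_)
    have y1 := mul_trace_mul_cfc_sq_le (c := 2 * q - 1) (k := q)
      (linComb_posSemidef (fun i => mul_self_posSemidef (hH i)) (fun i => sq_nonneg (x i ω)))
      (hY fun i => x i ω) (by linarith) hq
    have y2 := mul_trace_mul_cfc_sq_le (c := 2 * q - 1) (k := q)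
      (posSemidef_sum Finset.univ fun i _ => mul_self_posSemidef (hH i))
      (hY fun i => x i ω) (by linarith) hq
    simp only
    linarith
  rw [integral_add ((I cX).const_mul _) (I (G := fun y => 1 / 4 * (4 * (2 * q - 1)) ^ q *
      (tracePow q (∑ i, H i * H i) + tracePow q (linComb (fun i => H i * H i) fun i => y i ^ 2)))
      (by fun_prop)),
    integral_const_mul, integral_const_mul, integral_add (integrable_const _) (I cS)] at s4
  simp only [integral_const, probReal_univ, one_smul] at s4
  linarith

/-- Moments of the sum `S = ∑ x i ^ 2 • H i` with positive semidefinite coefficients. The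
covariance bound for `x i ^ 2` replaces `x i ^ 2` by its mean, up to a multiple of
`trace (H i ^ 2 * S ^ (q - 2))`. Young's inequality splits the latter into `trace (H i ^ q)` and a
small multiple of `trace (H i * S ^ (q - 1))`. With the weights `x i ^ 2 + 1` these add up to
`trace (S ^ q)`, which is absorbed, and `trace ((∑ H i) * S ^ (q - 1))`. -/
theorem integral_tracePow_sq_le (hmeas : ∀ i, Measurable (x i)) (hindep : iIndepFun x P)
    (hL : 1 ≤ L) (hb : ∀ i, ∀ᵐ ω ∂P, |x i ω| ≤ L)
    (hvar : ∀ i, ∫ ω, x i ω ^ 2 ∂P ≤ 1) (hH : ∀ i, (H i).PosSemidef) {q : ℝ} (hq : 2 < q) :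
    ∫ ω, tracePow q (linComb H fun i => x i ω ^ 2) ∂P ≤
      1 / 2 * 5 ^ q * tracePow q (∑ i, H i) +
        (4 * (L ^ 2 * (q - 1))) ^ (q - 1) * ∑ i, tracePow q (H i) := by
  set Y : (Fin n → ℝ) → Matrix κ κ ℝ := fun y => linComb H fun i => y i ^ 2 with hYdef
  set X := fun ω => Y fun i => x i ω with hX
  set g : ℝ → ℝ := fun x => |x| ^ (q - 2) with hg
  set f : ℝ → ℝ := fun x => x * |x| ^ (q - 2) with hf
  have cg : Continuous g := continuous_abs_rpow (by linarith)
  have cf : Continuous f := continuous_mul_abs_rpow (by linarith)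
  have pY : ∀ y, (Y y).PosSemidef := fun y => linComb_posSemidef hH fun i => sq_nonneg (y i)
  have hY := fun y => (pY y).1
  have cY : Continuous Y := continuous_linComb.comp (by fun_prop)
  have I : ∀ {G : (Fin n → ℝ) → ℝ}, Continuous G → Integrable (fun ω => G fun i => x i ω) P :=
    fun hG => integrable_continuous_comp hmeas hb hG
  have cΦ : ∀ i, Continuous fun y => trace (H i * cfc f (Y y)) := fun i =>
    continuous_trace_mul_cfc cf continuous_const cY hY
  have cΨ : ∀ i, Continuous fun y => (q - 2 + 1) * trace (H i * H i * cfc g (Y y)) :=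
    fun i => (continuous_trace_mul_cfc cg continuous_const cY hY).const_mul _
  have cT : Continuous fun y => tracePow q (Y y) := continuous_tracePow (by linarith) cY hY
  have s1 : ∫ ω, tracePow q (X ω) ∂P = ∑ i, ∫ ω, x i ω ^ 2 * trace (H i * cfc f (X ω)) ∂P := by
    rw [← integral_finsetSum _ fun i _ => I (G := fun y => y i ^ 2 * trace (H i * cfc f (Y y)))
      ((by fun_prop : Continuous fun y : Fin n → ℝ => y i ^ 2).mul (cΦ i))]
    refine integral_congr_ae (Filter.Eventually.of_forall fun ω => ?_)
    simp only
    rw [← trace_linComb_mul, ← trace_mul_self_cfc (hY _) (by linarith)]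
  have hL2 : 0 < L ^ 2 := by positivity
  have s2 : ∀ i, ∫ ω, x i ω ^ 2 * trace (H i * cfc f (X ω)) ∂P ≤
      ∫ ω, trace (H i * cfc f (X ω)) ∂P + ∫ ω, L ^ 2 * (x i ω ^ 2 + 1) *
        ((q - 2 + 1) * trace (H i * H i * cfc g (X ω))) ∂P := by
    intro i
    have I1 := fun {G : ℝ → ℝ} (hG : Continuous G) =>
      integrable_continuous_comp_one (hmeas i) (hb i) hG
    have hsq : ∀ᵐ ω ∂P, x i ω ^ 2 ≤ L ^ 2 := by
      filter_upwards [hb i] with ω hω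
      exact sq_le_sq' (abs_le.mp hω).1 (abs_le.mp hω).2
    -- The second moment of `ζ (x i) = x i ^ 2` is at most `L ^ 2`.
    have h4 : ∫ ω, (x i ω ^ 2) ^ 2 ∂P ≤ L ^ 2 := by
      calc ∫ ω, (x i ω ^ 2) ^ 2 ∂P ≤ ∫ ω, L ^ 2 * x i ω ^ 2 ∂P := by
            refine integral_mono_ae (I1 (G := fun a => (a ^ 2) ^ 2) (by fun_prop))
              (I1 (G := fun a => L ^ 2 * a ^ 2) (by fun_prop)) ?_
            filter_upwards [hsq] with ω hω
            nlinarith [sq_nonneg (x i ω)]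
        _ ≤ L ^ 2 := by
            rw [integral_const_mul]
            nlinarith [hvar i]
    have h0 : 0 ≤ ∫ ω, x i ω ^ 2 ∂P := integral_nonneg fun ω => sq_nonneg _
    have := integral_coord_mul_le hmeas hindep hb i (ζ := fun a => a ^ 2)
      (w := fun a => L ^ 2 * (a ^ 2 + 1)) (by fun_prop) (by fun_prop) (cΦ i) (cΨ i)
      (fun y => mul_nonneg (by linarith) (trace_mul_cfc_nonneg
        (mul_self_posSemidef (hH i).1) (hY y) fun _ => by positivity))
      (fun y a b => by
        have := sub_mul_trace_sub_le (fun i => (hH i).1) (r := q - 2) (by linarith)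
          (fun j => y j ^ 2) i (a ^ 2) (b ^ 2)
        rw [← update_sq, ← update_sq] at this
        exact this)
      (by
        filter_upwards [hsq] with ω hω
        nlinarith [sq_nonneg (x i ω), mul_nonneg h0 (sq_nonneg (x i ω))])
    refine this.trans (add_le_add_left ?_ _)
    exact mul_le_of_le_one_left (integral_nonneg fun ω =>
      trace_mul_cfc_mul_abs_rpow_nonneg (hH i) (pY _) _) (hvar i)
  set K := (4 * (L ^ 2 * (q - 1))) ^ (q - 1) with hK
  have s3 : ∀ i, ∫ ω, L ^ 2 * (x i ω ^ 2 + 1) *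
        ((q - 2 + 1) * trace (H i * H i * cfc g (X ω))) ∂P ≤
      ∫ ω, (1 / 4 * (x i ω ^ 2 * trace (H i * cfc f (X ω))) +
        1 / 4 * trace (H i * cfc f (X ω)) +
        1 / 4 * K * tracePow q (H i) * (x i ω ^ 2 + 1)) ∂P := by
    intro i
    have cΦi := cΦ i
    refine integral_mono (I (G := fun y => L ^ 2 * (y i ^ 2 + 1) *
        ((q - 2 + 1) * trace (H i * H i * cfc g (Y y))))
        ((by fun_prop : Continuous fun y : Fin n → ℝ => L ^ 2 * (y i ^ 2 + 1)).mul (cΨ i)))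
      (I (G := fun y => 1 / 4 * (y i ^ 2 * trace (H i * cfc f (Y y))) +
        1 / 4 * trace (H i * cfc f (Y y)) +
        1 / 4 * K * tracePow q (H i) * (y i ^ 2 + 1)) (by fun_prop)) fun ω => ?_
    have := mul_le_mul_of_nonneg_left (mul_trace_mul_mul_cfc_le (c := L ^ 2 * (q - 1)) (k := q)
      (hH i) (pY fun i => x i ω) (mul_pos hL2 (by linarith)) hq)
      (by positivity : 0 ≤ x i ω ^ 2 + 1)
    simp only
    linarith
  have s4 : ∀ i, ∫ ω, (1 / 4 * (x i ω ^ 2 * trace (H i * cfc f (X ω))) +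
        1 / 4 * trace (H i * cfc f (X ω)) +
        1 / 4 * K * tracePow q (H i) * (x i ω ^ 2 + 1)) ∂P ≤
      1 / 4 * ∫ ω, x i ω ^ 2 * trace (H i * cfc f (X ω)) ∂P +
        1 / 4 * ∫ ω, trace (H i * cfc f (X ω)) ∂P + 1 / 2 * K * tracePow q (H i) := by
    intro i
    have cΦi := cΦ i
    rw [integral_add (I (G := fun y => 1 / 4 * (y i ^ 2 * trace (H i * cfc f (Y y))) +
        1 / 4 * trace (H i * cfc f (Y y))) (by fun_prop))
      (I (G := fun y => 1 / 4 * K * tracePow q (H i) * (y i ^ 2 + 1)) (by fun_prop)),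
      integral_add (I (G := fun y => 1 / 4 * (y i ^ 2 * trace (H i * cfc f (Y y))))
        (by fun_prop)) (I (G := fun y => 1 / 4 * trace (H i * cfc f (Y y))) (by fun_prop)),
      integral_const_mul, integral_const_mul, integral_const_mul,
      integral_add (I (G := fun y => y i ^ 2) (by fun_prop)) (integrable_const _)]
    simp only [integral_const, probReal_univ, one_smul]
    have hKt : 0 ≤ 1 / 4 * K * tracePow q (H i) :=
      mul_nonneg (mul_nonneg (by norm_num) (Real.rpow_nonneg (by nlinarith) _))
        (tracePow_nonneg (hH i).1 _)
    nlinarith [mul_le_mul_of_nonneg_left (hvar i) hKt]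
  have s5 : ∑ i, ∫ ω, trace (H i * cfc f (X ω)) ∂P =
      ∫ ω, trace ((∑ i, H i) * cfc f (X ω)) ∂P := by
    rw [← integral_finsetSum _ fun i _ => I (cΦ i)]
    refine integral_congr_ae (Filter.Eventually.of_forall fun ω => ?_)
    simp only
    rw [Finset.sum_mul, trace_sum]
  -- The factor `5 / 4 = 1 + 1 / 4` collects the terms in `∑ i, H i` from `s2` and `s4`.
  have s6 : 5 / 4 * ∫ ω, trace ((∑ i, H i) * cfc f (X ω)) ∂P ≤
      1 / 4 * ∫ ω, tracePow q (X ω) ∂P + 1 / 4 * 5 ^ q * tracePow q (∑ i, H i) := by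
    have c3 : Continuous fun y => trace ((∑ i, H i) * cfc f (Y y)) :=
      continuous_trace_mul_cfc cf continuous_const cY hY
    have : 1 / 4 * ∫ ω, tracePow q (X ω) ∂P + 1 / 4 * 5 ^ q * tracePow q (∑ i, H i) =
        ∫ ω, (1 / 4 * tracePow q (X ω) + 1 / 4 * 5 ^ q * tracePow q (∑ i, H i)) ∂P := by
      rw [integral_add ((I cT).const_mul _) (integrable_const _), integral_const_mul]
      simp [hX]
    rw [this, ← integral_const_mul]
    refine integral_mono ((I c3).const_mul _) (((I cT).const_mul _).add (integrable_const _))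
      fun ω => ?_
    have := mul_trace_mul_cfc_le (c := 5 / 4) (k := q)
      (posSemidef_sum Finset.univ fun i _ => hH i) (pY fun i => x i ω) (by norm_num) (by linarith)
    norm_num at this ⊢
    exact this
  have s7 := Finset.sum_le_sum fun i (_ : i ∈ Finset.univ) =>
    (s2 i).trans (add_le_add_right ((s3 i).trans (s4 i)) _)
  simp only [Finset.sum_add_distrib, ← Finset.mul_sum] at s7
  rw [← s1, s5] at s7
  linarith

/-- A Rosenthal inequality for linear combinations of symmetric matrices. -/
theorem integral_tracePow_linComb_le (hmeas : ∀ i, Measurable (x i)) (hindep : iIndepFun x P)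
    (hL : 1 ≤ L) (hb : ∀ i, ∀ᵐ ω ∂P, |x i ω| ≤ L) (hmean : ∀ i, ∫ ω, x i ω ∂P = 0)
    (hvar : ∀ i, ∫ ω, x i ω ^ 2 ∂P ≤ 1) (hH : ∀ i, (H i).IsHermitian) {q : ℝ} (hq : 2 < q) :
    ∫ ω, tracePow (2 * q) (linComb H fun i => x i ω) ∂P ≤
      (64 * q ^ 2) ^ q * (tracePow q (∑ i, H i * H i) +
        (L ^ 2) ^ q * ∑ i, tracePow q (H i * H i)) := by
  have h1 := integral_tracePow_le_of_sq hmeas hindep hb hmean hvar hH (q := q) (by linarith)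
  have h2 := integral_tracePow_sq_le hmeas hindep hL hb hvar
    (fun i => mul_self_posSemidef (hH i)) hq
  set D := tracePow q (∑ i, H i * H i)
  set R := ∑ i, tracePow q (H i * H i)
  have hD : 0 ≤ D := tracePow_nonneg
    (posSemidef_sum Finset.univ fun i _ => mul_self_posSemidef (hH i)).1 _
  have hR : 0 ≤ R := Finset.sum_nonneg fun i _ => tracePow_nonneg (mul_self_posSemidef (hH i)).1 _
  have hL2 : 1 ≤ L ^ 2 := one_le_pow₀ hL
  have e1 : (4 * (L ^ 2 * (q - 1))) ^ (q - 1) ≤ (4 * (L ^ 2 * q)) ^ q :=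
    (Real.rpow_le_rpow_of_exponent_le (by nlinarith) (by linarith)).trans
      (Real.rpow_le_rpow (by nlinarith) (by nlinarith) (by linarith))
  have e2 : (4 * (2 * q - 1)) ^ q ≤ (8 * q) ^ q :=
    Real.rpow_le_rpow (by linarith) (by linarith) (by linarith)
  have e5 : (1 : ℝ) ≤ 5 ^ q := Real.one_le_rpow (by norm_num) (by linarith)
  calc _ ≤ _ := h1
    _ ≤ 1 / 2 * (8 * q) ^ q * (D + (1 / 2 * 5 ^ q * D + (4 * (L ^ 2 * q)) ^ q * R)) := by
        refine mul_le_mul (by gcongr) (by gcongr; exact h2.trans (by gcongr)) ?_ (by positivity)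
        exact add_nonneg hD (integral_nonneg fun ω => tracePow_nonneg (linComb_posSemidef
          (fun i => mul_self_posSemidef (hH i)) fun i => sq_nonneg (x i ω)).1 _)
    _ ≤ (8 * q) ^ q * (5 ^ q * D + (4 * (L ^ 2 * q)) ^ q * R) := by
        have : D ≤ 5 ^ q * D := le_mul_of_one_le_left hD e5
        have h8 : 0 ≤ (8 * q) ^ q := by positivity
        have h9 : 0 ≤ (4 * (L ^ 2 * q)) ^ q * R := by positivity
        rw [mul_comm (1 / 2) _, mul_assoc]
        gcongr
        linarith
    _ = (40 * q) ^ q * D + (32 * q ^ 2) ^ q * ((L ^ 2) ^ q * R) := by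
        have a1 : (8 * q) ^ q * 5 ^ q = (40 * q) ^ q := by
          rw [← Real.mul_rpow (by positivity) (by positivity)]; ring_nf
        have a2 : (8 * q) ^ q * (4 * (L ^ 2 * q)) ^ q = (32 * q ^ 2) ^ q * (L ^ 2) ^ q := by
          rw [← Real.mul_rpow (by positivity) (by positivity),
            ← Real.mul_rpow (by positivity) (by positivity)]
          ring_nf
        rw [mul_add, ← mul_assoc, a1, ← mul_assoc, a2, mul_assoc]
    _ ≤ (64 * q ^ 2) ^ q * D + (64 * q ^ 2) ^ q * ((L ^ 2) ^ q * R) := by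
        gcongr ?_ * _ + ?_ * _ <;>
          exact Real.rpow_le_rpow (by positivity) (by nlinarith) (by linarith)
    _ = _ := by ring

end symmetric

/-! ### Schatten norms and rectangular matrices -/

section spectral
variable {ι κ : Type*} [Fintype ι] [Fintype κ] [DecidableEq ι] [DecidableEq κ]

theorem tracePow_eq_sum_roots {X : Matrix ι ι ℝ} (hX : X.IsHermitian) (r : ℝ) :
    tracePow r X = (X.charpoly.roots.map fun a => |a| ^ r).sum := by
  rw [tracePow, trace_cfc hX, hX.roots_charpoly_eq_eigenvalues, Multiset.map_map]
  rfl

theorem tracePow_congr_charpoly {X : Matrix ι ι ℝ} {Y : Matrix κ κ ℝ} (hX : X.IsHermitian)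
    (hY : Y.IsHermitian) (h : X.charpoly = Y.charpoly) (r : ℝ) : tracePow r X = tracePow r Y := by
  rw [tracePow_eq_sum_roots hX, tracePow_eq_sum_roots hY, h]

/-- The matrices `Bᴴ * B` and `B * Bᴴ` have the same nonzero eigenvalues; a zero eigenvalue
contributes `0 ^ r`, which is `0` only for `r ≠ 0`. -/
theorem tracePow_conjTranspose_mul_self (B : Matrix ι κ ℝ) {r : ℝ} (hr : r ≠ 0) :
    tracePow r (Bᴴ * B) = tracePow r (B * Bᴴ) := by
  rw [tracePow_eq_sum_roots (isHermitian_conjTranspose_mul_self B),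
    tracePow_eq_sum_roots (isHermitian_mul_conjTranspose_self B)]
  have h := congrArg Polynomial.roots (charpoly_mul_comm' B Bᴴ)
  rw [Polynomial.roots_mul (mul_ne_zero (pow_ne_zero _ Polynomial.X_ne_zero)
      (charpoly_monic _).ne_zero),
    Polynomial.roots_mul (mul_ne_zero (pow_ne_zero _ Polynomial.X_ne_zero)
      (charpoly_monic _).ne_zero), Polynomial.roots_X_pow, Polynomial.roots_X_pow] at h
  have h2 := congrArg (fun s : Multiset ℝ => (s.map fun a => |a| ^ r).sum) h
  simpa [Multiset.map_nsmul, Multiset.sum_nsmul, Real.zero_rpow hr] using h2.symm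

theorem tracePow_fromBlocks_diagonal {A : Matrix ι ι ℝ} {D : Matrix κ κ ℝ} (hA : A.IsHermitian)
    (hD : D.IsHermitian) (r : ℝ) :
    tracePow r (fromBlocks A 0 0 D) = tracePow r A + tracePow r D := by
  have h : (fromBlocks A 0 0 D).IsHermitian := hA.fromBlocks (by simp) hD
  rw [tracePow_eq_sum_roots h, tracePow_eq_sum_roots hA, tracePow_eq_sum_roots hD,
    charpoly_fromBlocks_zero₁₂, Polynomial.roots_mul (mul_ne_zero (charpoly_monic _).ne_zero
      (charpoly_monic _).ne_zero), Multiset.map_add, Multiset.sum_add]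

theorem tracePow_blockDiagonal {o : Type*} [Fintype o] [DecidableEq o] {M : o → Matrix κ κ ℝ}
    (hM : ∀ i, (M i).IsHermitian) (r : ℝ) :
    tracePow r (blockDiagonal M) = ∑ i, tracePow r (M i) := by
  have h : (blockDiagonal M).IsHermitian := by
    rw [IsHermitian, blockDiagonal_conjTranspose]
    exact congrArg _ (funext fun i => (hM i).eq)
  have hc : (blockDiagonal M).charpoly = ∏ i, (M i).charpoly := by
    have : (blockDiagonal M).charmatrix = blockDiagonal fun i => (M i).charmatrix := by
      ext ⟨a, i⟩ ⟨b, j⟩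
      by_cases hij : i = j
      · subst hij
        by_cases hab : a = b
        · subst hab; simp [blockDiagonal_apply]
        · simp [blockDiagonal_apply, hab]
      · simp [blockDiagonal_apply, hij]
    rw [charpoly, this, det_blockDiagonal]
    rfl
  have hne : ∏ i, (M i).charpoly ≠ 0 := Finset.prod_ne_zero_iff.mpr fun i _ =>
    (charpoly_monic (M i)).ne_zero
  rw [tracePow_eq_sum_roots h, hc, Polynomial.roots_prod _ _ hne, Multiset.map_bind,
    Multiset.sum_bind]
  exact Finset.sum_congr rfl fun i _ => (tracePow_eq_sum_roots (hM i) r).symm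

theorem tracePow_mul_self {H : Matrix ι ι ℝ} (hH : H.IsHermitian) {q : ℝ} (hq : 0 ≤ q) :
    tracePow q (H * H) = tracePow (2 * q) H := by
  have h1 : H * H = cfc (fun x : ℝ => x * x) H := by
    rw [← cfc_mul_cfc hH (fun x => x) fun x => x, cfc_id_of_isHermitian hH]
  rw [tracePow, tracePow, h1, ← cfc_comp' (fun x : ℝ => |x| ^ q) (fun x : ℝ => x * x) H
    (continuous_abs_rpow hq).continuousOn (by fun_prop) hH.isSelfAdjoint]
  congr 2
  ext x
  rw [abs_mul, ← pow_two, ← Real.rpow_natCast_mul (abs_nonneg _), Nat.cast_ofNat]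

theorem tracePow_smul {H : Matrix ι ι ℝ} (hH : H.IsHermitian) {r : ℝ} (hr : 0 ≤ r) (c : ℝ) :
    tracePow r (c • H) = |c| ^ r * tracePow r H := by
  have h1 : c • H = cfc (fun x : ℝ => c * x) H := by
    rw [← cfc_mul_cfc hH (fun _ => c) fun x => x, cfc_id_of_isHermitian hH,
      cfc_const c H hH.isSelfAdjoint]
    simp [Algebra.algebraMap_eq_smul_one]
  rw [h1, tracePow, ← cfc_comp' (fun x : ℝ => |x| ^ r) (fun x : ℝ => c * x) H
    (continuous_abs_rpow hr).continuousOn (by fun_prop) hH.isSelfAdjoint, trace_cfc hH,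
    tracePow, trace_cfc hH, Finset.mul_sum]
  exact Finset.sum_congr rfl fun i _ => by
    rw [abs_mul, Real.mul_rpow (by positivity) (by positivity)]

/-- Convexity of `tracePow p`: the subgradient inequality at `∑ a i • F i` is averaged. -/
theorem tracePow_sum_smul_le {s : Type*} [Fintype s] {a : s → ℝ} (ha : ∀ i, 0 ≤ a i)
    (ha1 : ∑ i, a i = 1) {F : s → Matrix ι ι ℝ} (hF : ∀ i, (F i).IsHermitian) {p : ℝ}
    (hp : 1 < p) : tracePow p (∑ i, a i • F i) ≤ ∑ i, a i * tracePow p (F i) := by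
  set Z := ∑ i, a i • F i with hZdef
  have hZ : Z.IsHermitian := by
    rw [IsHermitian, hZdef, conjTranspose_sum]
    exact Finset.sum_congr rfl fun i _ => by rw [conjTranspose_smul, (hF i).eq, star_trivial]
  have h1 : p * tracePow p Z = ∑ i, a i *
      (p * trace (F i * cfc (fun x : ℝ => x * |x| ^ (p - 2)) Z)) := by
    rw [← trace_mul_self_cfc hZ (by linarith)]
    nth_rw 1 [hZdef]
    rw [Finset.sum_mul, trace_sum, Finset.mul_sum]
    refine Finset.sum_congr rfl fun i _ => ?_
    rw [smul_mul_assoc, trace_smul, smul_eq_mul]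
    ring
  have h2 : ∑ i, a i * (p * trace (F i * cfc (fun x : ℝ => x * |x| ^ (p - 2)) Z)) ≤
      ∑ i, a i * (tracePow p (F i) + (p - 1) * tracePow p Z) :=
    Finset.sum_le_sum fun i _ =>
      mul_le_mul_of_nonneg_left (trace_mul_cfc_le_tracePow (hF i) hZ hp) (ha i)
  simp only [mul_add, Finset.sum_add_distrib] at h2
  rw [← Finset.sum_mul, ha1] at h2
  linarith

end spectral

section schatten
variable {ι κ : Type*} [Fintype ι] [Fintype κ] [DecidableEq κ]

theorem schattenNorm_eq (p : ℝ) (B : Matrix ι κ ℝ) :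
    schattenNorm p B = tracePow (p / 2) (Bᴴ * B) ^ (1 / p) := by
  rw [tracePow, trace_cfc (isHermitian_conjTranspose_mul_self B), schattenNorm]
  congr 1
  refine Finset.sum_congr rfl fun i _ => ?_
  rw [abs_of_nonneg ((posSemidef_conjTranspose_mul_self B).eigenvalues_nonneg i)]

theorem schattenNorm_nonneg (p : ℝ) (B : Matrix ι κ ℝ) : 0 ≤ schattenNorm p B := by
  rw [schattenNorm_eq]
  exact Real.rpow_nonneg (tracePow_nonneg (isHermitian_conjTranspose_mul_self B) _) _

theorem schattenNorm_rpow {p : ℝ} (hp : 0 < p) (B : Matrix ι κ ℝ) :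
    schattenNorm p B ^ p = tracePow (p / 2) (Bᴴ * B) := by
  rw [schattenNorm_eq, ← Real.rpow_mul
    (tracePow_nonneg (isHermitian_conjTranspose_mul_self B) _), one_div_mul_cancel hp.ne',
    Real.rpow_one]

theorem schattenNorm_rpow_eq_mul_conjTranspose [DecidableEq ι] {p : ℝ} (hp : 0 < p)
    (B : Matrix ι κ ℝ) :
    schattenNorm p B ^ p = tracePow (p / 2) (B * Bᴴ) := by
  rw [schattenNorm_rpow hp, tracePow_conjTranspose_mul_self B (by positivity)]

theorem continuous_schattenNorm {T : Type*} [TopologicalSpace T] {p : ℝ} (hp : 0 < p)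
    {B : T → Matrix ι κ ℝ} (hB : Continuous B) : Continuous fun y => schattenNorm p (B y) := by
  simp only [schattenNorm_eq]
  exact (continuous_tracePow (by positivity) (by fun_prop)
    fun y => isHermitian_conjTranspose_mul_self (B y)).rpow_const fun _ => Or.inr (by positivity)

theorem schattenNorm_smul {p : ℝ} (hp : 0 < p) (c : ℝ) (B : Matrix ι κ ℝ) :
    schattenNorm p (c • B) = |c| * schattenNorm p B := by
  rw [schattenNorm_eq, schattenNorm_eq, conjTranspose_smul, star_trivial, Matrix.smul_mul,
    Matrix.mul_smul, smul_smul,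
    tracePow_smul (isHermitian_conjTranspose_mul_self B) (by positivity),
    Real.mul_rpow (by positivity) (tracePow_nonneg (isHermitian_conjTranspose_mul_self B) _),
    abs_mul, ← pow_two, ← Real.rpow_natCast, ← Real.rpow_mul (abs_nonneg c),
    ← Real.rpow_mul (abs_nonneg c)]
  congr 1
  rw [show ((2 : ℕ) : ℝ) * (p / 2) * (1 / p) = 1 by push_cast; field_simp, Real.rpow_one]

theorem schattenNorm_zero {p : ℝ} (hp : 0 < p) : schattenNorm p (0 : Matrix ι κ ℝ) = 0 := by
  simpa using schattenNorm_smul hp 0 (0 : Matrix ι κ ℝ)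

theorem schattenNorm_submatrix {ι' κ' : Type*} [Fintype ι'] [Fintype κ'] [DecidableEq κ']
    (p : ℝ) (B : Matrix ι κ ℝ) (e : ι' ≃ ι) (f : κ' ≃ κ) :
    schattenNorm p (B.submatrix e f) = schattenNorm p B := by
  have h : (B.submatrix e f)ᴴ * B.submatrix e f = reindex f.symm f.symm (Bᴴ * B) := by
    rw [conjTranspose_submatrix, submatrix_mul_equiv]
    rfl
  rw [schattenNorm_eq, schattenNorm_eq]
  congr 1
  refine tracePow_congr_charpoly (isHermitian_conjTranspose_mul_self _)
    (isHermitian_conjTranspose_mul_self _) ?_ _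
  rw [h, charpoly_reindex]

/-- The symmetric dilation of a rectangular matrix, with `B` above the diagonal and its transpose
below. It is linear in `B`, and its nonzero eigenvalues are those singular values of `B` that do
not vanish, with both signs. -/
def dilation (B : Matrix ι κ ℝ) : Matrix (ι ⊕ κ) (ι ⊕ κ) ℝ := fromBlocks 0 B Bᴴ 0

omit [Fintype ι] [Fintype κ] [DecidableEq κ] in
theorem dilation_isHermitian (B : Matrix ι κ ℝ) : (dilation B).IsHermitian :=
  isHermitian_zero.fromBlocks (by simp) isHermitian_zero

omit [DecidableEq κ] in
theorem dilation_mul_dilation (B : Matrix ι κ ℝ) :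
    dilation B * dilation B = fromBlocks (B * Bᴴ) 0 0 (Bᴴ * B) := by
  simp [dilation, fromBlocks_multiply]

omit [Fintype ι] [Fintype κ] [DecidableEq κ] in
theorem dilation_sum_smul {s : Type*} [Fintype s] (y : s → ℝ) (B : s → Matrix ι κ ℝ) :
    dilation (∑ i, y i • B i) = ∑ i, y i • dilation (B i) := by
  ext (a | a) (b | b) <;>
    simp [dilation, Matrix.sum_apply, fromBlocks]

theorem tracePow_dilation [DecidableEq ι] {q : ℝ} (hq : 0 < q) (B : Matrix ι κ ℝ) :
    tracePow (2 * q) (dilation B) = 2 * schattenNorm (2 * q) B ^ (2 * q) := by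
  rw [← tracePow_mul_self (dilation_isHermitian B) hq.le, dilation_mul_dilation,
    tracePow_fromBlocks_diagonal (isHermitian_mul_conjTranspose_self B)
      (isHermitian_conjTranspose_mul_self B), two_mul (schattenNorm _ _ ^ _)]
  nth_rw 1 [schattenNorm_rpow_eq_mul_conjTranspose (by positivity)]
  rw [schattenNorm_rpow (by positivity), mul_div_cancel_left₀ _ two_ne_zero]

theorem schattenNorm_rpow_sum_smul_le {s : Type*} [Fintype s] {a : s → ℝ} (ha : ∀ i, 0 ≤ a i)
    (ha1 : ∑ i, a i = 1) (F : s → Matrix ι κ ℝ) {p : ℝ} (hp : 1 < p) :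
    schattenNorm p (∑ i, a i • F i) ^ p ≤ ∑ i, a i * schattenNorm p (F i) ^ p := by
  classical
  obtain ⟨q, rfl⟩ : ∃ q, p = 2 * q := ⟨p / 2, by ring⟩
  have h := tracePow_sum_smul_le ha ha1 (fun i => dilation_isHermitian (F i)) hp
  rw [← dilation_sum_smul] at h
  simp only [tracePow_dilation (by linarith : 0 < q), mul_left_comm _ (2 : ℝ)] at h
  rw [← Finset.mul_sum] at h
  linarith

end schatten

instance : Fintype Dir := ⟨{.vert, .horiz, .diag}, fun u => by cases u <;> simp⟩

theorem sum_dir (f : Dir → ℝ) : ∑ u, f u = f .vert + f .horiz + f .diag := by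
  simp [Finset.sum, Finset.univ, Fintype.elems, add_assoc]

/-- The factor `L` that a diagonal arrangement contributes to the bound. -/
def Dir.weight (L : ℝ) : Dir → ℝ
  | .diag => L
  | _ => 1

theorem Dir.arrange_sum_smul {n : ℕ} {ι κ s : Type*} [Fintype s] (y : s → ℝ)
    (B : s → Fin n → Matrix ι κ ℝ) (u : Dir) :
    u.arrange (fun j => ∑ i, y i • B i j) = ∑ i, y i • u.arrange (B i) := by
  cases u <;> ext r c <;> simp [Dir.arrange, Matrix.sum_apply]

section linear
variable {n : ℕ} {ι κ : Type*} [Fintype ι] [Fintype κ] [DecidableEq κ]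

theorem schattenNorm_vert_rpow {p : ℝ} (hp : 0 < p) (B : Fin n → Matrix ι κ ℝ) :
    schattenNorm p (Dir.vert.arrange B) ^ p = tracePow (p / 2) (∑ i, (B i)ᴴ * B i) := by
  rw [schattenNorm_rpow hp]
  congr 1
  ext a b
  rw [Matrix.sum_apply, mul_apply]
  exact Fintype.sum_prod_type _

theorem schattenNorm_horiz_rpow [DecidableEq ι] {p : ℝ} (hp : 0 < p) (B : Fin n → Matrix ι κ ℝ) :
    schattenNorm p (Dir.horiz.arrange B) ^ p = tracePow (p / 2) (∑ i, B i * (B i)ᴴ) := by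
  rw [schattenNorm_rpow_eq_mul_conjTranspose hp]
  congr 1
  ext a b
  rw [Matrix.sum_apply, mul_apply]
  exact Fintype.sum_prod_type _

theorem schattenNorm_diag_rpow {p : ℝ} (hp : 0 < p) (B : Fin n → Matrix ι κ ℝ) :
    schattenNorm p (Dir.diag.arrange B) ^ p = ∑ i, schattenNorm p (B i) ^ p := by
  have h : Dir.diag.arrange B = (blockDiagonal B).submatrix (Equiv.prodComm (Fin n) ι)
      (Equiv.prodComm (Fin n) κ) := rfl
  rw [h]
  refine (congrArg (· ^ p) (schattenNorm_submatrix p (blockDiagonal B) _ _)).trans ?_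
  simp only [schattenNorm_rpow hp]
  rw [← tracePow_blockDiagonal fun i => isHermitian_conjTranspose_mul_self (B i),
    blockDiagonal_conjTranspose, ← blockDiagonal_mul]

end linear

section linearBound
variable {Ω : Type*} [MeasurableSpace Ω] {P : Measure Ω} [IsProbabilityMeasure P] {n : ℕ}
  {x : Fin n → Ω → ℝ} {L : ℝ} {ι κ : Type*} [Fintype ι] [Fintype κ] [DecidableEq κ]

/-- A Rosenthal inequality for linear combinations of rectangular matrices. The blocks of the
squared dilations are `B i * (B i)ᴴ` and `(B i)ᴴ * B i`; the sums over `i` give the horizontal and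
the vertical arrangement. -/
theorem integral_schattenNorm_rpow_sum_smul_le (hmeas : ∀ i, Measurable (x i))
    (hindep : iIndepFun x P) (hL : 1 ≤ L) (hb : ∀ i, ∀ᵐ ω ∂P, |x i ω| ≤ L)
    (hmean : ∀ i, ∫ ω, x i ω ∂P = 0) (hvar : ∀ i, ∫ ω, x i ω ^ 2 ∂P ≤ 1)
    (B : Fin n → Matrix ι κ ℝ) {p : ℝ} (hp : 4 < p) :
    ∫ ω, schattenNorm p (∑ i, x i ω • B i) ^ p ∂P ≤
      (4 * p) ^ p * ∑ u : Dir, (u.weight L * schattenNorm p (u.arrange B)) ^ p := by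
  classical
  obtain ⟨q, rfl⟩ : ∃ q, p = 2 * q := ⟨p / 2, by ring⟩
  have hq : 0 < q := by linarith
  have h := integral_tracePow_linComb_le hmeas hindep hL hb hmean hvar
    (fun i => dilation_isHermitian (B i)) (q := q) (by linarith)
  have e1 : ∀ ω, tracePow (2 * q) (linComb (fun i => dilation (B i)) fun i => x i ω) =
      2 * schattenNorm (2 * q) (∑ i, x i ω • B i) ^ (2 * q) := fun ω => by
    rw [linComb, ← dilation_sum_smul, tracePow_dilation hq]
  have e2 : tracePow q (∑ i, dilation (B i) * dilation (B i)) =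
      schattenNorm (2 * q) (Dir.horiz.arrange B) ^ (2 * q) +
        schattenNorm (2 * q) (Dir.vert.arrange B) ^ (2 * q) := by
    rw [schattenNorm_horiz_rpow (by positivity), schattenNorm_vert_rpow (by positivity),
      mul_div_cancel_left₀ _ two_ne_zero, ← tracePow_fromBlocks_diagonal]
    · congr 1
      simp only [dilation_mul_dilation]
      ext (a | a) (b | b) <;> simp [Matrix.sum_apply, fromBlocks]
    · exact (posSemidef_sum Finset.univ fun i _ => posSemidef_self_mul_conjTranspose (B i)).1
    · exact (posSemidef_sum Finset.univ fun i _ => posSemidef_conjTranspose_mul_self (B i)).1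
  have e3 : ∑ i, tracePow q (dilation (B i) * dilation (B i)) =
      2 * schattenNorm (2 * q) (Dir.diag.arrange B) ^ (2 * q) := by
    rw [schattenNorm_diag_rpow (by positivity), Finset.mul_sum]
    exact Finset.sum_congr rfl fun i _ => by
      rw [tracePow_mul_self (dilation_isHermitian _) hq.le, tracePow_dilation hq]
  have e4 : (4 * (2 * q)) ^ (2 * q) = (64 * q ^ 2) ^ q := by
    rw [Real.rpow_mul (by positivity), Real.rpow_two]
    ring_nf
  have e5 : (L * schattenNorm (2 * q) (Dir.diag.arrange B)) ^ (2 * q) =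
      (L ^ 2) ^ q * schattenNorm (2 * q) (Dir.diag.arrange B) ^ (2 * q) := by
    rw [Real.mul_rpow (by positivity) (schattenNorm_nonneg _ _), Real.rpow_mul (by positivity),
      Real.rpow_two]
  simp only [e1] at h
  rw [integral_const_mul, e2, e3] at h
  rw [sum_dir, e4]
  simp only [Dir.weight, one_mul, e5]
  have n1 := Real.rpow_nonneg (schattenNorm_nonneg (2 * q) (Dir.horiz.arrange B)) (2 * q)
  have n2 := Real.rpow_nonneg (schattenNorm_nonneg (2 * q) (Dir.vert.arrange B)) (2 * q)
  have n3 := mul_nonneg (by positivity : 0 ≤ (64 * q ^ 2) ^ q) (add_nonneg n1 n2)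
  linarith

end linearBound

/-! ### Decoupling -/

theorem sum_rpow_le_rpow_sum {s : Type*} (t : Finset s) {f : s → ℝ} (hf : ∀ i, 0 ≤ f i) {p : ℝ}
    (hp : 1 ≤ p) : ∑ i ∈ t, f i ^ p ≤ (∑ i ∈ t, f i) ^ p := by
  classical
  induction t using Finset.induction_on with
  | empty => simp [Real.zero_rpow (by linarith : p ≠ 0)]
  | insert a t ha ih =>
    rw [Finset.sum_insert ha, Finset.sum_insert ha]
    exact (add_le_add_right ih _).trans
      (Real.add_rpow_le_rpow_add (hf a) (Finset.sum_nonneg fun i _ => hf i) hp)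

section decoupling
variable {Ω : Type*} [MeasurableSpace Ω] {P : Measure Ω} [IsProbabilityMeasure P] {n : ℕ}
  {x : Fin n → Ω → ℝ} {L : ℝ} {ι κ : Type*}

/-- The decoupled chaos `∑ y i * z j • C i j`, grouped by `j` so that it is visibly linear in
`z`. -/
def bilinearForm (C : Fin n → Fin n → Matrix ι κ ℝ) (y z : Fin n → ℝ) : Matrix ι κ ℝ :=
  ∑ j, z j • ∑ i, y i • C i j

theorem continuous_bilinearForm (C : Fin n → Fin n → Matrix ι κ ℝ) :
    Continuous fun w : (Fin n → ℝ) × (Fin n → ℝ) => bilinearForm C w.1 w.2 := by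
  unfold bilinearForm
  fun_prop

/-- A quarter of all sets contain `i` but not `j`. -/
theorem sum_finset_mem_mul_mem_compl {i j : Fin n} (hij : i ≠ j) :
    ∑ S : Finset (Fin n), (if i ∈ S then (1 : ℝ) else 0) * (if j ∈ Sᶜ then 1 else 0) =
      2 ^ n / 4 := by
  -- Expand `∏ k, (f k + g k)` over all sets, with `f j = g i = 0` and all other values `1`.
  have h := Finset.prod_add (fun k : Fin n => if k = j then (0 : ℝ) else 1)
    (fun k => if k = i then (0 : ℝ) else 1) Finset.univ
  rw [Finset.powerset_univ] at h
  simp only [Finset.prod_ite_eq', ← Finset.compl_eq_univ_sdiff] at h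
  have e : ∀ k : Fin n, ((if k = j then (0 : ℝ) else 1) + if k = i then (0 : ℝ) else 1) =
      2 * ((if k = j then 1 / 2 else 1) * if k = i then 1 / 2 else 1) := by
    intro k
    by_cases h1 : k = j <;> by_cases h2 : k = i
    · exact absurd (h2.symm.trans h1) hij
    all_goals simp [h1, h2, hij, hij.symm] <;> norm_num
  simp only [e, Finset.prod_mul_distrib, Finset.prod_ite_eq', Finset.mem_univ, if_true,
    Finset.prod_const, Finset.card_univ, Fintype.card_fin] at h
  rw [show (2 : ℝ) ^ n / 4 = 2 ^ n * (1 / 2 * (1 / 2)) by ring, h]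
  refine Finset.sum_congr rfl fun S _ => ?_
  by_cases h1 : i ∈ S <;> by_cases h2 : j ∈ S <;> simp [h1, h2]

/-- A quadratic form without diagonal terms is the average, over all sets `S`, of four times its
part with first index in `S` and second index outside `S`. -/
theorem bilinearForm_eq_sum_mask {C : Fin n → Fin n → Matrix ι κ ℝ} (hC : ∀ i, C i i = 0)
    (y : Fin n → ℝ) : bilinearForm C y y = ∑ S : Finset (Fin n),
      ((1 / 2 : ℝ) ^ n) • ((4 : ℝ) • bilinearForm C (mask S y) (mask Sᶜ y)) := by
  ext r s
  simp only [bilinearForm, Matrix.sum_apply, Matrix.smul_apply, smul_eq_mul, Finset.mul_sum, mask]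
  symm
  rw [Finset.sum_comm]
  refine Finset.sum_congr rfl fun j _ => ?_
  rw [Finset.sum_comm]
  refine Finset.sum_congr rfl fun i _ => ?_
  rcases eq_or_ne i j with rfl | hij
  · simp [hC]
  have h := sum_finset_mem_mul_mem_compl hij
  have e : ∀ S : Finset (Fin n), (1 / 2 : ℝ) ^ n * (4 * ((if j ∈ Sᶜ then y j else 0) *
      ((if i ∈ S then y i else 0) * C i j r s))) = (1 / 2 : ℝ) ^ n * 4 * (y j * (y i * C i j r s)) *
      ((if i ∈ S then (1 : ℝ) else 0) * (if j ∈ Sᶜ then 1 else 0)) := by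
    intro S
    split_ifs <;> ring
  simp only [e]
  rw [← Finset.mul_sum, h, one_div, inv_pow]
  field_simp

variable [Fintype ι] [Fintype κ] [DecidableEq κ]

/-- Masking replaces some of the variables by `0`, which preserves the hypotheses of
`integral_schattenNorm_rpow_sum_smul_le`; this is why variances below `1` are allowed there. -/
theorem integral_schattenNorm_rpow_sum_mask_le (hmeas : ∀ i, Measurable (x i))
    (hindep : iIndepFun x P) (hL : 1 ≤ L) (hb : ∀ i, ∀ᵐ ω ∂P, |x i ω| ≤ L)
    (hmean : ∀ i, ∫ ω, x i ω ∂P = 0) (hvar : ∀ i, ∫ ω, x i ω ^ 2 ∂P ≤ 1) (S : Finset (Fin n))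
    (B : Fin n → Matrix ι κ ℝ) {p : ℝ} (hp : 4 < p) :
    ∫ ω, schattenNorm p (∑ i, mask S (fun j => x j ω) i • B i) ^ p ∂P ≤
      (4 * p) ^ p * ∑ u : Dir, (u.weight L * schattenNorm p (u.arrange B)) ^ p := by
  have hm : ∀ i, Measurable fun y : ℝ => if i ∈ S then y else 0 := by
    intro i
    split_ifs <;> fun_prop
  refine integral_schattenNorm_rpow_sum_smul_le
    (x := fun i ω => if i ∈ S then x i ω else 0) (fun i => (hm i).comp (hmeas i))
    (hindep.comp _ hm) hL (fun i => ?_) (fun i => ?_) (fun i => ?_) B hp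
  · filter_upwards [hb i] with ω hω
    split_ifs
    · exact hω
    · simpa using by linarith
  · split_ifs
    · exact hmean i
    · simp
  · split_ifs
    · exact hvar i
    · simp

omit [IsProbabilityMeasure P] in
theorem integrable_schattenNorm_rpow_sum_mask [IsFiniteMeasure P] (hmeas : ∀ i, Measurable (x i))
    (hb : ∀ i, ∀ᵐ ω ∂P, |x i ω| ≤ L) (S : Finset (Fin n)) (B : Fin n → Matrix ι κ ℝ) {p : ℝ}
    (hp : 0 < p) :
    Integrable (fun ω => schattenNorm p (∑ i, mask S (fun j => x j ω) i • B i) ^ p) P := by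
  refine integrable_continuous_comp hmeas hb
    (G := fun y => schattenNorm p (∑ i, mask S y i • B i) ^ p)
    ((continuous_schattenNorm hp ?_).rpow_const fun _ => Or.inr hp.le)
  have := continuous_mask S
  fun_prop

/-- The linear bound is applied first in the coordinates outside `S`, with those in `S` held fixed.
The resulting block matrices are linear in the coordinates in `S`, and it is applied once more. -/
theorem integral_schattenNorm_bilinearForm_mask_le (hmeas : ∀ i, Measurable (x i))
    (hindep : iIndepFun x P) (hL : 1 ≤ L) (hb : ∀ i, ∀ᵐ ω ∂P, |x i ω| ≤ L)
    (hmean : ∀ i, ∫ ω, x i ω ∂P = 0) (hvar : ∀ i, ∫ ω, x i ω ^ 2 ∂P ≤ 1) (S : Finset (Fin n))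
    (C : Fin n → Fin n → Matrix ι κ ℝ) {p : ℝ} (hp : 4 < p) :
    ∫ ω, schattenNorm p (bilinearForm C (mask S fun i => x i ω) (mask Sᶜ fun i => x i ω)) ^ p ∂P ≤
      (4 * p) ^ p * ((4 * p) ^ p * ∑ v : Dir, ∑ u : Dir, (v.weight L * (u.weight L *
        schattenNorm p (u.arrange fun i => v.arrange (C i)))) ^ p) := by
  have hp0 : 0 < p := by linarith
  have hw : ∀ v : Dir, 0 ≤ v.weight L := by
    intro v
    cases v
    · exact zero_le_one
    · exact zero_le_one
    · exact zero_le_one.trans hL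
  have cN : Continuous fun z : (Fin n → ℝ) × (Fin n → ℝ) =>
      schattenNorm p (bilinearForm C z.1 z.2) ^ p :=
    (continuous_schattenNorm hp0 (continuous_bilinearForm C)).rpow_const
      fun _ => Or.inr hp0.le
  rw [integral_mask_mask_compl hmeas hindep hb S
    (G := fun y z => schattenNorm p (bilinearForm C y z) ^ p) cN]
  have inner : ∀ ω, ∫ ω', schattenNorm p (bilinearForm C (mask S fun i => x i ω)
      (mask Sᶜ fun i => x i ω')) ^ p ∂P ≤ (4 * p) ^ p * ∑ v : Dir, v.weight L ^ p *
        schattenNorm p (∑ i, mask S (fun i => x i ω) i • v.arrange (C i)) ^ p := by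
    intro ω
    refine (integral_schattenNorm_rpow_sum_mask_le hmeas hindep hL hb hmean hvar Sᶜ
      (fun j => ∑ i, mask S (fun i => x i ω) i • C i j) hp).trans_eq ?_
    congr 1
    refine Finset.sum_congr rfl fun v _ => ?_
    rw [Dir.arrange_sum_smul, Real.mul_rpow (hw v) (schattenNorm_nonneg _ _)]
  have cM : Continuous fun z : (Fin n → ℝ) × (Fin n → ℝ) =>
      schattenNorm p (bilinearForm C (mask S z.1) (mask Sᶜ z.2)) ^ p :=
    cN.comp (f := fun z : (Fin n → ℝ) × (Fin n → ℝ) => (mask S z.1, mask Sᶜ z.2))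
      (((continuous_mask S).comp continuous_fst).prodMk ((continuous_mask Sᶜ).comp continuous_snd))
  have I1 : Integrable (fun ω => ∫ ω', schattenNorm p (bilinearForm C (mask S fun i => x i ω)
      (mask Sᶜ fun i => x i ω')) ^ p ∂P) P :=
    Integrable.integral_prod_left (integrable_continuous_comp_prod hmeas hb
      (G := fun y z => schattenNorm p (bilinearForm C (mask S y) (mask Sᶜ z)) ^ p) cM)
  have I2 : ∀ v : Dir, Integrable (fun ω => v.weight L ^ p *
      schattenNorm p (∑ i, mask S (fun i => x i ω) i • v.arrange (C i)) ^ p) P := by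
    intro v
    exact (integrable_schattenNorm_rpow_sum_mask hmeas hb S _ hp0).const_mul _
  refine (integral_mono I1 ((integrable_finsetSum _ fun v _ => I2 v).const_mul _) inner).trans ?_
  rw [integral_const_mul, integral_finsetSum _ fun v _ => I2 v]
  refine mul_le_mul_of_nonneg_left ?_ (by positivity)
  rw [Finset.mul_sum]
  refine Finset.sum_le_sum fun v _ => ?_
  rw [integral_const_mul]
  refine (mul_le_mul_of_nonneg_left (integral_schattenNorm_rpow_sum_mask_le hmeas hindep hL hb
    hmean hvar S (fun i => v.arrange (C i)) hp) (Real.rpow_nonneg (hw v) _)).trans_eq ?_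
  rw [mul_left_comm, Finset.mul_sum]
  congr 1
  refine Finset.sum_congr rfl fun u _ => ?_
  rw [Real.mul_rpow (hw v) (mul_nonneg (hw u) (schattenNorm_nonneg _ _))]

/-- The bound for a quadratic chaos: convexity of the `p`-th power of the norm passes to the
average over sets in `bilinearForm_eq_sum_mask`, and `p`-th moments dominate first moments. -/
theorem integral_schattenNorm_bilinearForm_le (hmeas : ∀ i, Measurable (x i))
    (hindep : iIndepFun x P) (hL : 1 ≤ L) (hb : ∀ i, ∀ᵐ ω ∂P, |x i ω| ≤ L)
    (hmean : ∀ i, ∫ ω, x i ω ∂P = 0) (hvar : ∀ i, ∫ ω, x i ω ^ 2 ∂P ≤ 1)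
    {C : Fin n → Fin n → Matrix ι κ ℝ} (hC : ∀ i, C i i = 0) {p : ℝ} (hp : 4 < p) :
    ∫ ω, schattenNorm p (bilinearForm C (fun i => x i ω) fun i => x i ω) ∂P ≤
      64 * p ^ 2 * ∑ v : Dir, ∑ u : Dir, v.weight L * (u.weight L *
        schattenNorm p (u.arrange fun i => v.arrange (C i))) := by
  have hp0 : 0 < p := by linarith
  have hw : ∀ v : Dir, 0 ≤ v.weight L := by
    intro v
    cases v
    · exact zero_le_one
    · exact zero_le_one
    · exact zero_le_one.trans hL
  set c : Dir × Dir → ℝ := fun z => z.1.weight L * (z.2.weight L *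
    schattenNorm p (z.2.arrange fun i => z.1.arrange (C i))) with hc
  have hc0 : ∀ z, 0 ≤ c z := fun z =>
    mul_nonneg (hw _) (mul_nonneg (hw _) (schattenNorm_nonneg _ _))
  have cN : Continuous fun y : Fin n → ℝ => schattenNorm p (bilinearForm C y y) :=
    continuous_schattenNorm hp0 ((continuous_bilinearForm C).comp
      (continuous_id.prodMk continuous_id))
  have cNp : Continuous fun y : Fin n → ℝ => schattenNorm p (bilinearForm C y y) ^ p :=
    cN.rpow_const fun _ => Or.inr hp0.le
  have cS : ∀ S : Finset (Fin n), Continuous fun y : Fin n → ℝ =>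
      schattenNorm p (bilinearForm C (mask S y) (mask Sᶜ y)) ^ p := fun S =>
    (continuous_schattenNorm hp0 ((continuous_bilinearForm C).comp
      ((continuous_mask S).prodMk (continuous_mask Sᶜ)))).rpow_const fun _ => Or.inr hp0.le
  have I : ∀ {G : (Fin n → ℝ) → ℝ}, Continuous G → Integrable (fun ω => G fun i => x i ω) P :=
    fun hG => integrable_continuous_comp hmeas hb hG
  have hsum1 : ∑ _S : Finset (Fin n), (1 / 2 : ℝ) ^ n = 1 := by
    simp
  set K := (4 * p) ^ p * ((4 * p) ^ p * ∑ v : Dir, ∑ u : Dir, c (v, u) ^ p) with hK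
  have h1 : ∫ ω, schattenNorm p (bilinearForm C (fun i => x i ω) fun i => x i ω) ^ p ∂P ≤
      4 ^ p * K := by
    calc ∫ ω, schattenNorm p (bilinearForm C (fun i => x i ω) fun i => x i ω) ^ p ∂P
        ≤ ∫ ω, ∑ S : Finset (Fin n), (1 / 2 : ℝ) ^ n * (4 ^ p * schattenNorm p
          (bilinearForm C (mask S fun i => x i ω) (mask Sᶜ fun i => x i ω)) ^ p) ∂P := by
          refine integral_mono (I cNp) (integrable_finsetSum _ fun S _ =>
            ((I (cS S)).const_mul _).const_mul _) fun ω => ?_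
          simp only
          rw [bilinearForm_eq_sum_mask hC]
          refine (schattenNorm_rpow_sum_smul_le (fun _ => by positivity) hsum1 _
            (by linarith)).trans_eq (Finset.sum_congr rfl fun S _ => ?_)
          rw [schattenNorm_smul hp0, abs_of_pos (by norm_num : (0 : ℝ) < 4),
            Real.mul_rpow (by norm_num) (schattenNorm_nonneg _ _)]
      _ = ∑ S : Finset (Fin n), (1 / 2 : ℝ) ^ n * (4 ^ p * ∫ ω, schattenNorm p
          (bilinearForm C (mask S fun i => x i ω) (mask Sᶜ fun i => x i ω)) ^ p ∂P) := by
          rw [integral_finsetSum _ fun S _ => ((I (cS S)).const_mul _).const_mul _]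
          simp only [integral_const_mul]
      _ ≤ ∑ S : Finset (Fin n), (1 / 2 : ℝ) ^ n * (4 ^ p * K) := by
          gcongr with S
          exact integral_schattenNorm_bilinearForm_mask_le hmeas hindep hL hb hmean hvar S C hp
      _ = 4 ^ p * K := by rw [← Finset.sum_mul, hsum1, one_mul]
  have h2 : 4 ^ p * K ≤ (64 * p ^ 2 * ∑ v : Dir, ∑ u : Dir, c (v, u)) ^ p := by
    rw [Real.mul_rpow (by positivity)
      (Finset.sum_nonneg fun v _ => Finset.sum_nonneg fun u _ => hc0 _)]
    -- The factor `4` is due to decoupling, and each family of variables contributes `4 * p`.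
    have e : (64 * p ^ 2) ^ p = 4 ^ p * ((4 * p) ^ p * (4 * p) ^ p) := by
      rw [← Real.mul_rpow (by positivity) (by positivity),
        ← Real.mul_rpow (by positivity) (by positivity)]
      ring_nf
    rw [e, hK, ← mul_assoc ((4 * p) ^ p) ((4 * p) ^ p), ← mul_assoc]
    refine mul_le_mul_of_nonneg_left ?_ (by positivity)
    rw [← Fintype.sum_prod_type', ← Fintype.sum_prod_type']
    exact sum_rpow_le_rpow_sum _ hc0 (by linarith)
  have h3 := (convexOn_rpow (by linarith : 1 ≤ p)).map_integral_le
    (continuous_id.rpow_const fun _ => Or.inr hp0.le).continuousOn isClosed_Ici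
    (Filter.Eventually.of_forall fun ω => schattenNorm_nonneg p
      (bilinearForm C (fun i => x i ω) fun i => x i ω)) (I cN) (I cNp)
  exact (Real.rpow_le_rpow_iff (integral_nonneg fun ω => schattenNorm_nonneg _ _)
    (mul_nonneg (by positivity) (Finset.sum_nonneg fun v _ => Finset.sum_nonneg fun u _ => hc0 _))
    hp0).mp (h3.trans (h1.trans h2))

end decoupling

/-! ### The coefficient blocks of a quadratic polynomial -/

section blocks
variable {n : ℕ} {ι κ : Type*}

/-- The blocks `A i j`, with the diagonal ones replaced by `0`. -/
def offDiagBlock (A : Fin n → Fin n → Matrix ι κ ℝ) (i j : Fin n) : Matrix ι κ ℝ :=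
  if i = j then 0 else A i j

theorem evalAt_quadratic (A : Fin n → Fin n → Matrix ι κ ℝ) (y : Fin n → ℝ) :
    (quadratic A).evalAt y = bilinearForm (offDiagBlock A) y y := by
  ext r s
  have h : (Finset.univ : Finset (Fin n)).offDiag =
      (Finset.univ : Finset (Fin n × Fin n)).filter fun z => z.1 ≠ z.2 := by
    ext z; simp
  simp only [PolyMatrix.evalAt, quadratic, map_apply, of_apply, map_sum, map_mul,
    MvPolynomial.eval_C, MvPolynomial.eval_X, bilinearForm, Matrix.sum_apply, Matrix.smul_apply,
    smul_eq_mul, Finset.mul_sum]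
  rw [h, Finset.sum_filter, Fintype.sum_prod_type, Finset.sum_comm]
  refine Finset.sum_congr rfl fun j _ => Finset.sum_congr rfl fun i _ => ?_
  by_cases hij : i = j
  · simp [offDiagBlock, hij]
  · simp [offDiagBlock, hij]
    ring

theorem Dir.arrange_map {R R' : Type*} [Zero R] [Zero R'] (f : R → R') (hf : f 0 = 0)
    (B : Fin n → Matrix ι κ R) (u : Dir) :
    (u.arrange B).map f = u.arrange fun i => (B i).map f := by
  cases u <;> ext r c <;> simp [Dir.arrange]
  split_ifs <;> simp [hf]

theorem Dir.arrange_smul (c : ℝ) (B : Fin n → Matrix ι κ ℝ) (u : Dir) :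
    (u.arrange fun i => c • B i) = c • u.arrange B := by
  cases u <;> ext r c <;> simp [Dir.arrange]

theorem eval_pderiv_pderiv_quadratic {A : Fin n → Fin n → Matrix ι κ ℝ}
    (hA : ∀ i j, i ≠ j → A i j = A j i) (y : Fin n → ℝ) (i j : Fin n) (r : ι) (s : κ) :
    MvPolynomial.eval y (MvPolynomial.pderiv i (MvPolynomial.pderiv j (quadratic A r s))) =
      2 * offDiagBlock A i j r s := by
  have h1 : ∀ p : Fin n × Fin n, MvPolynomial.eval y (MvPolynomial.pderiv i (MvPolynomial.pderiv j
      (MvPolynomial.C (A p.1 p.2 r s) * MvPolynomial.X p.1 * MvPolynomial.X p.2))) =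
      (if p = (j, i) then A j i r s else 0) + if p = (i, j) then A i j r s else 0 := by
    rintro ⟨a, b⟩
    simp only [MvPolynomial.pderiv_mul, MvPolynomial.pderiv_C, MvPolynomial.pderiv_X, map_add,
      map_mul, zero_mul, zero_add, MvPolynomial.eval_C, MvPolynomial.eval_X, Prod.mk.injEq]
    by_cases h1 : a = i <;> by_cases h2 : a = j <;> by_cases h3 : b = i <;> by_cases h4 : b = j <;>
      subst_vars <;> simp_all [eq_comm]
  simp only [quadratic, of_apply, map_sum, h1, Finset.sum_add_distrib, Finset.sum_ite_eq',
    Finset.mem_offDiag, Finset.mem_univ, true_and]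
  by_cases hij : i = j
  · simp [offDiagBlock, hij]
  · simp [offDiagBlock, hij, Ne.symm hij, hA i j hij]
    ring

theorem evalAt_derivBlock_derivBlock {A : Fin n → Fin n → Matrix ι κ ℝ}
    (hA : ∀ i j, i ≠ j → A i j = A j i) (y : Fin n → ℝ) (u v : Dir) :
    (((quadratic A).derivBlock v).derivBlock u).evalAt y = (2 : ℝ) • coeffBlock A u v := by
  have h : ∀ i, (((quadratic A).derivBlock v).map (MvPolynomial.pderiv i)).map
      (MvPolynomial.eval y) = (2 : ℝ) • v.arrange (offDiagBlock A i) := by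
    intro i
    rw [PolyMatrix.derivBlock, Dir.arrange_map _ (map_zero _), Dir.arrange_map _ (map_zero _),
      ← Dir.arrange_smul]
    congr 1
    ext j r s
    exact eval_pderiv_pderiv_quadratic hA y i j r s
  rw [PolyMatrix.evalAt, PolyMatrix.derivBlock, Dir.arrange_map _ (map_zero _)]
  simp only [h, Dir.arrange_smul]
  rfl

theorem coeffBlock_of_isEmpty (A : Fin 0 → Fin 0 → Matrix ι κ ℝ) (u v : Dir) :
    coeffBlock A u v = 0 := by
  have h : ∀ {ι' κ' : Type _} (B : Fin 0 → Matrix ι' κ' ℝ) (w : Dir), w.arrange B = 0 := by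
    intro ι' κ' B w
    cases w
    · ext ⟨i, _⟩ _; exact i.elim0
    · ext _ ⟨i, _⟩; exact i.elim0
    · ext ⟨i, _⟩ _; exact i.elim0
  exact h _ _

variable [Fintype ι] [Fintype κ] [DecidableEq κ]

/-- Exchange of the two outer block indices. -/
def swapOuter (n : ℕ) (α : Type*) : Fin n × Fin n × α ≃ Fin n × Fin n × α where
  toFun z := (z.2.1, z.1, z.2.2)
  invFun z := (z.2.1, z.1, z.2.2)
  left_inv _ := rfl
  right_inv _ := rfl

theorem schattenNorm_coeffBlock_comm {A : Fin n → Fin n → Matrix ι κ ℝ}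
    (hA : ∀ i j, i ≠ j → A i j = A j i) (p : ℝ) (u v : Dir) :
    schattenNorm p (coeffBlock A u v) = schattenNorm p (coeffBlock A v u) := by
  have hs : ∀ i j, (if i = j then (0 : Matrix ι κ ℝ) else A i j) =
      if j = i then 0 else A j i := by
    intro i j
    by_cases h : i = j
    · simp [h]
    · simp [h, Ne.symm h, hA i j h]
  -- With one vertical and one horizontal direction the block matrices agree; with a diagonal one
  -- they agree after the exchange of the two block indices of the rows or of the columns.
  have vh : schattenNorm p (coeffBlock A .vert .horiz) =
      schattenNorm p (coeffBlock A .horiz .vert) := by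
    have : coeffBlock A .vert .horiz = (coeffBlock A .horiz .vert :
        Matrix (Fin n × ι) (Fin n × κ) ℝ) := by
      ext ⟨i, r⟩ ⟨j, s⟩
      exact congrFun (congrFun (hs i j) r) s
    exact congrArg (schattenNorm (ι := Fin n × ι) (κ := Fin n × κ) p) this
  have vd : schattenNorm p (coeffBlock A .vert .diag) =
      schattenNorm p (coeffBlock A .diag .vert) := by
    have : coeffBlock A .vert .diag = Matrix.submatrix (coeffBlock A .diag .vert :
        Matrix (Fin n × Fin n × ι) (Fin n × κ) ℝ) (swapOuter n ι) (Equiv.refl _) := by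
      ext ⟨i, j, r⟩ ⟨k, s⟩
      change (if j = k then (if i = j then 0 else A i j) r s else 0) =
        if j = k then (if j = i then (0 : Matrix ι κ ℝ) else A j i) r s else 0
      rw [hs i j]
    exact (congrArg (schattenNorm (ι := Fin n × Fin n × ι) (κ := Fin n × κ) p) this).trans
      (schattenNorm_submatrix _ _ _ _)
  have hd : schattenNorm p (coeffBlock A .horiz .diag) =
      schattenNorm p (coeffBlock A .diag .horiz) := by
    have : coeffBlock A .horiz .diag = Matrix.submatrix (coeffBlock A .diag .horiz :
        Matrix (Fin n × ι) (Fin n × Fin n × κ) ℝ) (Equiv.refl _) (swapOuter n κ) := by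
      ext ⟨k, r⟩ ⟨i, j, s⟩
      change (if k = j then (if i = k then 0 else A i k) r s else 0) =
        if k = j then (if k = i then (0 : Matrix ι κ ℝ) else A k i) r s else 0
      rw [hs i k]
    exact (congrArg (schattenNorm (ι := Fin n × ι) (κ := Fin n × Fin n × κ) p) this).trans
      (schattenNorm_submatrix _ _ _ _)
  cases u <;> cases v
  exacts [rfl, vh, vd, vh.symm, rfl, hd, vd.symm, hd.symm, rfl]

theorem IsOrder.eq_or_swap {u v u' v' : Dir} {k : Fin 3 → ℕ} (h : IsOrder u v k)
    (h' : IsOrder u' v' k) : (u = u' ∧ v = v') ∨ (u = v' ∧ v = u') := by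
  obtain ⟨a, b, c⟩ := h
  obtain ⟨a', b', c'⟩ := h'
  rw [← a'] at a
  rw [← b'] at b
  rw [← c'] at c
  clear a' b' c'
  revert u v u' v'
  decide

theorem IsOrder.pow_eq_weight_mul_weight {u v : Dir} {k : Fin 3 → ℕ} (h : IsOrder u v k) (L : ℝ) :
    L ^ k 2 = v.weight L * u.weight L := by
  rw [← h.2.2]
  cases u <;> cases v <;> simp [Dir.weight, pow_two]

/-- Each triple of numbers of increments is reached by at most two orders, which give the same norm
by the symmetry of `A`. -/
theorem sum_weight_mul_schattenNorm_le {A : Fin n → Fin n → Matrix ι κ ℝ}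
    (hA : ∀ i j, i ≠ j → A i j = A j i) {L : ℝ} (hL : 0 ≤ L) (p : ℝ)
    {u v : (Fin 3 → ℕ) → Dir}
    (huv : ∀ k ∈ Finset.Nat.antidiagonalTuple 3 2, IsOrder (u k) (v k) k) :
    ∑ v' : Dir, ∑ u' : Dir, v'.weight L * (u'.weight L * schattenNorm p (coeffBlock A u' v')) ≤
      2 * ∑ k ∈ Finset.Nat.antidiagonalTuple 3 2,
        L ^ k 2 * schattenNorm p (coeffBlock A (u k) (v k)) := by
  have e : Finset.Nat.antidiagonalTuple 3 2 =
      {![2, 0, 0], ![1, 1, 0], ![1, 0, 1], ![0, 2, 0], ![0, 1, 1], ![0, 0, 2]} := by decide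
  have key : ∀ k ∈ Finset.Nat.antidiagonalTuple 3 2, ∀ u' v', IsOrder u' v' k →
      v'.weight L * (u'.weight L * schattenNorm p (coeffBlock A u' v')) =
        L ^ k 2 * schattenNorm p (coeffBlock A (u k) (v k)) := by
    intro k hk u' v' h
    rw [← mul_assoc, ← h.pow_eq_weight_mul_weight]
    rcases h.eq_or_swap (huv k hk) with ⟨h1, h2⟩ | ⟨h1, h2⟩
    · rw [h1, h2]
    · rw [h1, h2, schattenNorm_coeffBlock_comm hA]
  have nn : ∀ k : Fin 3 → ℕ, 0 ≤ L ^ k 2 * schattenNorm p (coeffBlock A (u k) (v k)) :=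
    fun k => mul_nonneg (pow_nonneg hL _) (schattenNorm_nonneg _ _)
  simp only [sum_dir]
  rw [key ![2, 0, 0] (by decide) .vert .vert (by unfold IsOrder; decide),
    key ![1, 1, 0] (by decide) .horiz .vert (by unfold IsOrder; decide),
    key ![1, 0, 1] (by decide) .diag .vert (by unfold IsOrder; decide),
    key ![1, 1, 0] (by decide) .vert .horiz (by unfold IsOrder; decide),
    key ![0, 2, 0] (by decide) .horiz .horiz (by unfold IsOrder; decide),
    key ![0, 1, 1] (by decide) .diag .horiz (by unfold IsOrder; decide),
    key ![1, 0, 1] (by decide) .vert .diag (by unfold IsOrder; decide),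
    key ![0, 1, 1] (by decide) .horiz .diag (by unfold IsOrder; decide),
    key ![0, 0, 2] (by decide) .diag .diag (by unfold IsOrder; decide), e,
    Finset.sum_insert (by decide), Finset.sum_insert (by decide), Finset.sum_insert (by decide),
    Finset.sum_insert (by decide), Finset.sum_insert (by decide), Finset.sum_singleton]
  linarith [nn ![2, 0, 0], nn ![0, 2, 0], nn ![0, 0, 2]]

end blocks

section expectation
variable {Ω : Type*} [MeasurableSpace Ω] {P : Measure Ω} [IsProbabilityMeasure P] {n : ℕ}
  {x : Fin n → Ω → ℝ} {L : ℝ} {ι κ : Type*}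

theorem expectation_quadratic (hmeas : ∀ i, Measurable (x i)) (hindep : iIndepFun x P)
    (hb : ∀ i, ∀ᵐ ω ∂P, |x i ω| ≤ L) (hmean : ∀ i, ∫ ω, x i ω ∂P = 0)
    (A : Fin n → Fin n → Matrix ι κ ℝ) :
    expectation P (fun ω => (quadratic A).evalAt fun i => x i ω) = 0 := by
  ext r s
  simp only [expectation, of_apply, PolyMatrix.evalAt, quadratic, map_apply, map_sum, map_mul,
    MvPolynomial.eval_C, MvPolynomial.eval_X, Matrix.zero_apply]
  rw [integral_finsetSum _ fun z _ => integrable_continuous_comp hmeas hb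
    (G := fun y => A z.1 z.2 r s * y z.1 * y z.2) (by fun_prop)]
  refine Finset.sum_eq_zero fun z hz => ?_
  simp only [mul_assoc]
  have hz' := hindep.indepFun (Finset.mem_offDiag.mp hz).2.2
  rw [integral_const_mul, hz'.integral_fun_mul_eq_mul_integral (hmeas _).aestronglyMeasurable
    (hmeas _).aestronglyMeasurable, hmean, zero_mul, mul_zero]

end expectation

end MatrixChaos

theorem mainTheorem5
    {Ω : Type*} [MeasurableSpace Ω] (P : Measure Ω) [IsProbabilityMeasure P]
    (n d₁ d₂ : ℕ) (L : ℝ) (x : Fin n → Ω → ℝ)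
    (hmeas : ∀ i, Measurable (x i))
    (hindep : iIndepFun x P)
    (hident : ∀ i j, IdentDistrib (x i) (x j) P P)
    (hmean : ∀ i, ∫ ω, x i ω ∂P = 0)
    (hvar : ∀ i, ∫ ω, x i ω ^ 2 ∂P = 1)
    (hbound : ∀ i, ∀ᵐ ω ∂P, |x i ω| ≤ L)
    (A : Fin n → Fin n → Matrix (Fin d₁) (Fin d₂) ℝ)
    (hsymm : ∀ i j, i ≠ j → A i j = A j i)
    (t : ℝ) (ht : 2 ≤ t)
    -- for each `(a, b, c)` with `a + b + c = 2`, any order of the increments leading to `F_{a,b,c}`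
    (u v : (Fin 3 → ℕ) → MatrixChaos.Dir)
    (huv : ∀ k ∈ Finset.Nat.antidiagonalTuple 3 2, MatrixChaos.IsOrder (u k) (v k) k) :
    let F : MatrixChaos.PolyMatrix n (Fin d₁) (Fin d₂) := MatrixChaos.quadratic A
    let M : Ω → Matrix (Fin d₁) (Fin d₂) ℝ := fun ω => F.evalAt fun i => x i ω
    let dev : Ω → ℝ := fun ω =>
      MatrixChaos.schattenNorm (4 * t) (M ω - MatrixChaos.expectation P M)
    Integrable dev P ∧
    -- the bound in terms of the block matrices with blocks `A_{i,j}`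
    (∫ ω, dev ω ∂P ≤ 2 * (32 * t) ^ 2 * ∑ k ∈ Finset.Nat.antidiagonalTuple 3 2,
      L ^ k 2 * MatrixChaos.schattenNorm (4 * t) (MatrixChaos.coeffBlock A (u k) (v k))) ∧
    -- the bound in terms of the block matrices of second order partial derivatives of `F`, which
    -- are constant, so that they may be evaluated at any point `y`
    (∀ y : Fin n → ℝ,
      ∫ ω, dev ω ∂P ≤ 2 * (32 * t) ^ 2 * ∑ k ∈ Finset.Nat.antidiagonalTuple 3 2,
        L ^ k 2 * MatrixChaos.schattenNorm (4 * t)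
          (((F.derivBlock (v k)).derivBlock (u k)).evalAt y)) := by
  intro F M dev
  have ht0 : (0 : ℝ) < 4 * t := by linarith
  have hdev : dev = fun ω => MatrixChaos.schattenNorm (4 * t)
      (MatrixChaos.bilinearForm (MatrixChaos.offDiagBlock A) (fun i => x i ω) fun i => x i ω) := by
    ext ω
    simp only [dev, M, F]
    rw [MatrixChaos.expectation_quadratic hmeas hindep hbound hmean, sub_zero,
      MatrixChaos.evalAt_quadratic]
  -- For `n = 0` the bound `L` is arbitrary, but then all the block matrices vanish.
  obtain ⟨L', hL', hb', hLL'⟩ : ∃ L' : ℝ, 1 ≤ L' ∧ (∀ i, ∀ᵐ ω ∂P, |x i ω| ≤ L') ∧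
      ∀ k : Fin 3 → ℕ, L ^ k 2 * MatrixChaos.schattenNorm (4 * t)
        (MatrixChaos.coeffBlock A (u k) (v k)) = L' ^ k 2 * MatrixChaos.schattenNorm (4 * t)
        (MatrixChaos.coeffBlock A (u k) (v k)) := by
    rcases n with _ | n
    · refine ⟨1, le_rfl, fun i => i.elim0, fun k => ?_⟩
      rw [MatrixChaos.coeffBlock_of_isEmpty, MatrixChaos.schattenNorm_zero ht0, mul_zero, mul_zero]
    · refine ⟨L, ?_, hbound, fun _ => rfl⟩
      have hL0 : 0 ≤ L := by
        obtain ⟨ω, hω⟩ := (hbound 0).exists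
        exact (abs_nonneg _).trans hω
      have h1 : (1 : ℝ) ≤ L ^ 2 := by
        calc (1 : ℝ) = ∫ ω, x 0 ω ^ 2 ∂P := (hvar 0).symm
          _ ≤ ∫ _ω, L ^ 2 ∂P := by
            refine integral_mono_ae (MatrixChaos.integrable_continuous_comp_one (hmeas 0)
              (hbound 0) (continuous_pow 2)) (integrable_const _) ?_
            filter_upwards [hbound 0] with ω hω
            exact sq_le_sq' (abs_le.mp hω).1 (abs_le.mp hω).2
          _ = L ^ 2 := by simp
      nlinarith
  have hN : ∀ k : Fin 3 → ℕ, 0 ≤ L' ^ k 2 * MatrixChaos.schattenNorm (4 * t)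
      (MatrixChaos.coeffBlock A (u k) (v k)) := fun k =>
    mul_nonneg (pow_nonneg (zero_le_one.trans hL') _) (MatrixChaos.schattenNorm_nonneg _ _)
  have hmain : ∫ ω, dev ω ∂P ≤ 2 * (32 * t) ^ 2 * ∑ k ∈ Finset.Nat.antidiagonalTuple 3 2,
      L' ^ k 2 * MatrixChaos.schattenNorm (4 * t) (MatrixChaos.coeffBlock A (u k) (v k)) := by
    rw [hdev]
    refine (MatrixChaos.integral_schattenNorm_bilinearForm_le hmeas hindep hL' hb' hmean
      (fun i => (hvar i).le) (fun i => if_pos rfl) (by linarith)).trans ?_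
    refine (mul_le_mul_of_nonneg_left (MatrixChaos.sum_weight_mul_schattenNorm_le hsymm
      (zero_le_one.trans hL') (4 * t) huv) (by positivity)).trans_eq ?_
    ring
  refine ⟨?_, ?_, fun y => ?_⟩
  · rw [hdev]
    exact MatrixChaos.integrable_continuous_comp hmeas hbound
      (G := fun y => MatrixChaos.schattenNorm (4 * t)
        (MatrixChaos.bilinearForm (MatrixChaos.offDiagBlock A) y y))
      (MatrixChaos.continuous_schattenNorm ht0
        ((MatrixChaos.continuous_bilinearForm _).comp (continuous_id.prodMk continuous_id)))
  · simpa only [hLL'] using hmain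
  · refine hmain.trans ?_
    -- The second order derivatives are twice the coefficients, and no term of the sum is negative.
    have h2 : ∀ k : Fin 3 → ℕ, L ^ k 2 * MatrixChaos.schattenNorm (4 * t)
        (((F.derivBlock (v k)).derivBlock (u k)).evalAt y) =
        2 * (L' ^ k 2 * MatrixChaos.schattenNorm (4 * t)
          (MatrixChaos.coeffBlock A (u k) (v k))) := fun k => by
      rw [← hLL', MatrixChaos.evalAt_derivBlock_derivBlock hsymm,
        MatrixChaos.schattenNorm_smul ht0, abs_two, mul_left_comm]
    simp only [h2]
    exact mul_le_mul_of_nonneg_left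
      (Finset.sum_le_sum fun k _ => by linarith [hN k]) (by positivity)
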